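/- Let $\mathbb{K}$ be a field of characteristic $0$, let $q\in\mathbb{K}\setminus\{0\}$ be not a root of unity, and let $\mathbb{K}[t,\sigma]\subseteq\mathbb{K}(t)[\sigma]$ be the skew polynomial rings in $\sigma$ with $\sigma t=qt\sigma$ and $\sigma c=c\sigma$ for $c\in\mathbb{K}$; the subring $\mathbb{K}[\sigma]$ is a commutative polynomial ring. An $m\times m$ matrix over $\mathbb{K}[t,\sigma]$ (resp. $\mathbb{K}[\sigma]$) is called *regular* if its rows are left linearly independent over $\mathbb{K}(t)[\sigma]$ (resp. $\mathbb{K}[\sigma]$). Matrices $A,B\in\mathbb{K}[t,\sigma]^{m\times m}$ are *equivalent* if $B=QA$ with $Q$ invertible in $\mathbb{K}(t)[\sigma]^{m\times m}$. If $A=t^\ell\tilde A_\ell+\dots+t\tilde A_1+\tilde A_0$ with $\tilde A_i\in\mathbb{K}[\sigma]^{m\times m}$, where $\ell$ is the degree of $A$ in $t$, then $\tilde A_\ell$ is the *$t$-leading matrix* of $A$; put $\rho(A)=\det\tilde A_\ell$, and call $A$ (and any system $A\bullet y=t^{-\nu}b$) *$t$-head regular* if $\rho(A)\neq0$. For a matrix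 $X=X(\sigma)$ over $\mathbb{K}[\sigma]$ put $X^{(\ell)}=X(q^\ell\sigma)$, so that $Xt^\ell=t^\ell X^{(\ell)}$. On $\mathbb{K}[\sigma]^{1\times m}$ order the terms by $e_i\sigma^a\le e_j\sigma^b$ iff $a<b$, or $a=b$ and $i\ge j$. A matrix is in *Popov normal form* if its rows form a minimal Gröbner basis for this ordering (with leading coefficients $1$); a row is *reducible* by it if some term occurring in the row is divisible by the leading term of a row of the matrix. Consider the following algorithm with input a regular matrix $A\in\mathbb{K}[t,\sigma]^{m\times m}$. 1. Let $\tilde A_\ell$ be the $t$-leading matrix of $A$. If $\det\tilde A_\ell\ne0$, return $A$. 2. Otherwise compute a matrix $U$, invertible in $\mathbb{K}[\sigma]^{m\times m}$, with $U\tilde A_\ell=\binom{P}{0}$, where $P$ has $r$ rows and is in Popov normal form. Replace $A$ by $XA$, where $X^{(\ell)}=U$. 3. Multiply the lower $m-r$ rows of $A$ from the left by $t$. Let $\ell$ be the degree in $t$ and $\binom{\tilde B}{\tilde C}$ the $t$-leading matrix of the new $A$, where $\tilde B$ consists of the upper $r$ rows. 4. Reduce $\tilde C$ by $\tilde B$: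 write $\tilde C=Z\tilde B+Y$ over $\mathbb{K}[\sigma]$, where no row of $Y$ is reducible by $\tilde B$. Replace $A$ by $\begin{pmatrix}1_r&0\\-X&1_{m-r}\end{pmatrix}A$, where $X^{(\ell)}=Z$. 5. If $Y=0$, go to step 3 (with the same $r$); otherwise go to step 1. **Theorem.** For every regular $A\in\mathbb{K}[t,\sigma]^{m\times m}$ the algorithm is correct and terminates, whatever choices are made in steps 2 and 4: every step can be carried out, no run is infinite, some matrix is returned, and every returned matrix $B\in\mathbb{K}[t,\sigma]^{m\times m}$ is equivalent to $A$ and has a regular $t$-leading matrix; moreover $\rho(B)\ne0$, that is, $B$ is $t$-head regular. -/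

import Mathlib

open Polynomial

noncomputable section

namespace QRec

variable {K : Type*} [Field K]

/-! ### The `q`-shift on `K[t]` and `K(t)` -/

/-- The `q`-shift on `K[t]`: the `K`-algebra endomorphism with `t ↦ q t`. -/
def polyShift (q : Kˣ) : K[X] →+* K[X] :=
  Polynomial.compRingHom (Polynomial.C (q : K) * Polynomial.X)

theorem polyShift_X (q : Kˣ) : polyShift q X = C (q : K) * X := by
  simp [polyShift]

theorem polyShift_C (q : Kˣ) (c : K) : polyShift q (C c) = C c := by
  simp [polyShift]

theorem polyShift_injective (q : Kˣ) : Function.Injective (polyShift q) := by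
  intro a b h
  have key : ∀ p : K[X], polyShift q⁻¹ (polyShift q p) = p := by
    intro p
    simp [polyShift, Polynomial.comp_assoc, ← mul_assoc, ← Polynomial.C_mul]
  rw [← key a, ← key b, h]

/-- The `q`-shift `σ` on `K(t)`, with `σ(t) = q t`. -/
def ratShift (q : Kˣ) : RatFunc K →+* RatFunc K :=
  RatFunc.mapRingHom (polyShift q)
    (nonZeroDivisors_le_comap_nonZeroDivisors_of_injective _ (polyShift_injective q))

theorem ratShift_algebraMap (q : Kˣ) (p : K[X]) :
    ratShift q (algebraMap K[X] (RatFunc K) p) = algebraMap K[X] (RatFunc K) (polyShift q p) := by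
  have h := RatFunc.map_apply_div (polyShift q)
    (nonZeroDivisors_le_comap_nonZeroDivisors_of_injective _ (polyShift_injective q)) p 1
  rwa [map_one, map_one, map_one, div_one, div_one] at h

/-- The polynomial ring `K[t]`, remembering `q`, so that it can carry the `q`-shift. -/
def PolyT (_q : Kˣ) : Type _ := K[X]

/-- The rational function field `K(t)`, remembering `q`, so that it can carry the `q`-shift. -/
def RatT (_q : Kˣ) : Type _ := RatFunc K

instance (q : Kˣ) : CommRing (PolyT q) := inferInstanceAs (CommRing K[X])

instance (q : Kˣ) : Field (RatT q) := inferInstanceAs (Field (RatFunc K))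

/-- The identity `K[t] = PolyT q`. -/
def toPolyT (q : Kˣ) : K[X] ≃+* PolyT q := RingEquiv.refl K[X]

/-- The identity `K(t) = RatT q`. -/
def toRatT (q : Kˣ) : RatFunc K ≃+* RatT q := RingEquiv.refl (RatFunc K)

/-- The `q`-shift on `PolyT q`. -/
def polyTShift (q : Kˣ) : PolyT q →+* PolyT q :=
  (toPolyT q).toRingHom.comp ((polyShift q).comp (toPolyT q).symm.toRingHom)

/-- The `q`-shift on `RatT q`. -/
def ratTShift (q : Kˣ) : RatT q →+* RatT q :=
  (toRatT q).toRingHom.comp ((ratShift q).comp (toRatT q).symm.toRingHom)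

/-- The natural number `n` acts on `K[t]` as the `n`-th power of the `q`-shift. -/
instance (q : Kˣ) : MulSemiringAction (Multiplicative ℕ) (PolyT q) :=
  MulSemiringAction.compHom (PolyT q) (powersHom (PolyT q →+* PolyT q) (polyTShift q))

/-- The natural number `n` acts on `K(t)` as the `n`-th power of the `q`-shift. -/
instance (q : Kˣ) : MulSemiringAction (Multiplicative ℕ) (RatT q) :=
  MulSemiringAction.compHom (RatT q) (powersHom (RatT q →+* RatT q) (ratTShift q))

theorem smul_polyT (q : Kˣ) (n : Multiplicative ℕ) (a : PolyT q) :
    n • a = (polyTShift q ^ n.toAdd) a := rfl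

theorem smul_ratT (q : Kˣ) (n : Multiplicative ℕ) (a : RatT q) :
    n • a = (ratTShift q ^ n.toAdd) a := rfl

/-- The inclusion `K[t] ⊆ K(t)`. -/
def polyToRat (q : Kˣ) : PolyT q →+* RatT q :=
  (toRatT q).toRingHom.comp ((algebraMap K[X] (RatFunc K)).comp (toPolyT q).symm.toRingHom)

theorem polyToRat_smul (q : Kˣ) (n : Multiplicative ℕ) (a : PolyT q) :
    polyToRat q (n • a) = n • polyToRat q a := by
  rw [smul_polyT, smul_ratT]
  induction n.toAdd generalizing a with
  | zero => rfl
  | succ k ih =>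
    rw [pow_succ, pow_succ, RingHom.mul_def, RingHom.mul_def, RingHom.comp_apply,
      RingHom.comp_apply, ih]
    congr 1
    simp [polyToRat, polyTShift, ratTShift, ratShift_algebraMap]

/-! ### The operator rings `K[t,σ]` and `K(t)[σ]` -/

/-- The ring `K[t,σ]` of operators `∑ αⱼ σʲ` with `αⱼ ∈ K[t]`, where `σ t = q t σ`. -/
abbrev PolyOp (q : Kˣ) : Type _ := SkewPolynomial (PolyT q)

/-- The ring `K(t)[σ]` of operators `∑ αⱼ σʲ` with `αⱼ ∈ K(t)`, where `σ t = q t σ`. -/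
abbrev RatOp (q : Kˣ) : Type _ := SkewPolynomial (RatT q)

/-- The inclusion `K[t] ⊆ K[t,σ]`. -/
def opPoly (q : Kˣ) : K[X] →+* PolyOp q :=
  SkewPolynomial.CRingHom.comp (toPolyT q).toRingHom

/-- The operator `t ∈ K[t,σ]`. -/
def opT (q : Kˣ) : PolyOp q := opPoly q X

/-- The operator `σ ∈ K[t,σ]`. -/
def opSigma (q : Kˣ) : PolyOp q := SkewPolynomial.X

theorem opSigma_mul_opPoly (q : Kˣ) (p : K[X]) :
    opSigma q * opPoly q p = opPoly q (polyShift q p) * opSigma q := by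
  simp only [opSigma, opPoly, RingHom.comp_apply, SkewPolynomial.CRingHom_eq_C]
  rw [← SkewPolynomial.monomial_zero_left, ← SkewPolynomial.monomial_zero_left,
    SkewPolynomial.X_mul_monomial, SkewPolynomial.monomial_mul_X]
  congr 1

/-- The commutation rule `σ t = q t σ`. -/
theorem opSigma_mul_opT (q : Kˣ) : opSigma q * opT q = opPoly q (C (q : K)) * opT q * opSigma q := by
  rw [opT, opSigma_mul_opPoly, polyShift_X, map_mul]

theorem opPoly_C_commute (q : Kˣ) (c : K) : Commute (opPoly q (C c)) (opSigma q) := by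
  rw [Commute, SemiconjBy, opSigma_mul_opPoly, polyShift_C]

/-- The inclusion `K[σ] ⊆ K[t,σ]`, where the commutative ring `K[σ]` is the polynomial ring over
`K` whose variable is sent to `σ`. -/
def sigmaEmb (q : Kˣ) : K[X] →+* PolyOp q :=
  Polynomial.eval₂RingHom' ((opPoly q).comp C) (opSigma q) (opPoly_C_commute q)

/-- The inclusion `K[t,σ] ⊆ K(t)[σ]`. -/
def toRatOp (q : Kˣ) : PolyOp q →+* RatOp q :=
  SkewMonoidAlgebra.liftNCRingHom
    ((SkewPolynomial.CRingHom : RatT q →+* RatOp q).comp (polyToRat q))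
    (powersHom (RatOp q) (SkewPolynomial.X : RatOp q))
    (by
      intro a n
      rw [powersHom_apply]
      simp only [RingHom.comp_apply, SkewPolynomial.CRingHom_eq_C]
      rw [← SkewPolynomial.monomial_zero_left, ← SkewPolynomial.monomial_zero_left,
        SkewPolynomial.X_pow_mul_monomial, SkewPolynomial.monomial_mul_X_pow,
        SkewPolynomial.φ_iterate_apply, polyToRat_smul]
      rfl)

/-! ### Operator matrices -/

variable {q : Kˣ} {m : ℕ}

/-- An operator matrix over `K[t,σ]` is regular if it has full left row rank, that is, if its rows
are left linearly independent over `K(t)[σ]`. -/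
def IsRegular (A : Matrix (Fin m) (Fin m) (PolyOp q)) : Prop :=
  LinearIndependent (RatOp q) (A.map (toRatOp q)).row

/-- `A` and `B` are equivalent if `B = Q A` for a matrix `Q` that is unimodular, that is,
invertible, over `K(t)[σ]`. -/
def Equivalent (A B : Matrix (Fin m) (Fin m) (PolyOp q)) : Prop :=
  ∃ Q : Matrix (Fin m) (Fin m) (RatOp q), IsUnit Q ∧ B.map (toRatOp q) = Q * A.map (toRatOp q)

/-- The coefficient `αⱼ ∈ K[t]` of `σʲ` in an operator `∑ αⱼ σʲ`. -/
def sigmaCoeff (p : PolyOp q) (j : ℕ) : K[X] :=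
  (toPolyT q).symm (SkewPolynomial.coeff p j)

/-- Writing an operator as `∑ᵢ tⁱ pᵢ(σ)`, this is `pᵢ ∈ K[σ]`; if the operator is `∑ⱼ αⱼ σʲ` and
`αⱼ = ∑ᵢ αⱼᵢ tⁱ`, then `pᵢ = ∑ⱼ αⱼᵢ σʲ`. -/
def tCoeff (i : ℕ) (p : PolyOp q) : K[X] :=
  ∑ j ∈ SkewPolynomial.support p, Polynomial.monomial j ((sigmaCoeff p j).coeff i)

/-- The degree `ℓ` in `t` of an operator matrix (`0` for the zero matrix). -/
def tDegree (A : Matrix (Fin m) (Fin m) (PolyOp q)) : ℕ :=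
  Finset.univ.sup fun i => Finset.univ.sup fun k =>
    (SkewPolynomial.support (A i k)).sup fun j => (sigmaCoeff (A i k) j).natDegree

/-- The `t`-leading matrix `Ã_ℓ = ∑ⱼ A_{jℓ} σʲ` of `A`, where `ℓ` is the degree of `A` in `t`. -/
def tLeading (A : Matrix (Fin m) (Fin m) (PolyOp q)) : Matrix (Fin m) (Fin m) K[X] :=
  A.map (tCoeff (tDegree A))

/-- The polynomial `ρ = det (∑ⱼ A_{jℓ} xʲ)`. -/
def rho (A : Matrix (Fin m) (Fin m) (PolyOp q)) : K[X] := (tLeading A).det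

/-- The system with operator matrix `A` is `t`-head regular. -/
def IsTHeadRegular (A : Matrix (Fin m) (Fin m) (PolyOp q)) : Prop := rho A ≠ 0

/-- For `X ∈ K[σ]`, the element `X^(ℓ) = X(q^ℓ σ)` of `K[σ]`, for which `X t^ℓ = t^ℓ X^(ℓ)`. -/
def twist (q : Kˣ) (l : ℕ) (p : K[X]) : K[X] :=
  p.comp (Polynomial.C ((q : K) ^ l) * Polynomial.X)

theorem sigmaEmb_mul_opT_pow (q : Kˣ) (l : ℕ) (p : K[X]) :
    sigmaEmb q p * opT q ^ l = opT q ^ l * sigmaEmb q (twist q l p) := by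
  have hc : ∀ c : K, Commute (opPoly q (C c)) (opT q) := fun c => by
    rw [Commute, SemiconjBy, opT, ← map_mul, ← map_mul, mul_comm]
  have hX : sigmaEmb q X = opSigma q := by simp [sigmaEmb]
  have hC : ∀ c, sigmaEmb q (C c) = opPoly q (C c) := fun c => by simp [sigmaEmb]
  have h1 : sigmaEmb q X * opT q ^ l = opT q ^ l * sigmaEmb q (twist q l X) := by
    rw [twist, X_comp, map_mul, hX, hC, ← mul_assoc]
    rw [← ((hc _).pow_right l).eq]
    induction l with
    | zero => simp
    | succ l ih =>
      rw [pow_succ, ← mul_assoc, ih, mul_assoc, opSigma_mul_opT, pow_succ (q : K), C_mul, map_mul]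
      simp only [← mul_assoc]
      rw [mul_assoc _ (opT q ^ l) (opPoly q (C (q : K))), ← ((hc _).pow_right l).eq, ← mul_assoc]
  induction p using Polynomial.induction_on' with
  | add a b ha hb => rw [map_add, add_mul, ha, hb, ← mul_add, ← map_add, twist, twist, twist, add_comp]
  | monomial n c =>
    rw [← C_mul_X_pow_eq_monomial, map_mul, map_pow]
    have h2 : sigmaEmb q X ^ n * opT q ^ l = opT q ^ l * sigmaEmb q (twist q l X) ^ n :=
      (SemiconjBy.pow_right (x := sigmaEmb q (twist q l X)) (y := sigmaEmb q X) h1.symm n).eq.symm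
    rw [mul_assoc, h2, ← mul_assoc, hC, ((hc _).pow_right l).eq, mul_assoc]
    simp [twist, hC]

/-! ### Popov normal form -/

/-- The term `e_pos σ^exp` of the module of row vectors over `K[σ]`. -/
structure Term (m : ℕ) where
  pos : Fin m
  exp : ℕ

/-- The term over position ordering: `e_i σ^a ≤ e_j σ^b` if `a < b`, or `a = b` and `i ≥ j`. -/
def Term.topLE (x y : Term m) : Prop := x.exp < y.exp ∨ (x.exp = y.exp ∧ y.pos ≤ x.pos)

/-- Divisibility of terms. -/
def Term.Divides (x y : Term m) : Prop := x.pos = y.pos ∧ x.exp ≤ y.exp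

/-- The coefficient of a term in a row vector. -/
def termCoeff (v : Fin m → K[X]) (x : Term m) : K := (v x.pos).coeff x.exp

/-- `x` is the leading term of `v`: the largest term that occurs in `v`. -/
def IsLeadingTerm (v : Fin m → K[X]) (x : Term m) : Prop :=
  termCoeff v x ≠ 0 ∧ ∀ y, termCoeff v y ≠ 0 → y.topLE x

/-- A family of rows is in Popov normal form: it is a minimal Gröbner basis, for the term over
position ordering, of the module that it generates. Minimal means that the leading coefficients
are `1` and that no leading term divides that of another member of the basis. -/
structure IsPopov {ι : Type*} (P : ι → Fin m → K[X]) : Prop where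
  monic : ∀ k, ∃ x, IsLeadingTerm (P k) x ∧ termCoeff (P k) x = 1
  groebner : ∀ v ∈ Submodule.span K[X] (Set.range P), v ≠ 0 →
    ∃ k x y, IsLeadingTerm (P k) x ∧ IsLeadingTerm v y ∧ x.Divides y
  minimal : ∀ k l, k ≠ l → ∀ x y, IsLeadingTerm (P k) x → IsLeadingTerm (P l) y → ¬ x.Divides y

/-- The row `v` is reducible by the rows `P`: some term that occurs in `v` is divisible by the
leading term of a member of `P`. -/
def IsReducible {ι : Type*} (P : ι → Fin m → K[X]) (v : Fin m → K[X]) : Prop :=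
  ∃ k x y, IsLeadingTerm (P k) x ∧ termCoeff v y ≠ 0 ∧ x.Divides y

/-! ### The algorithm -/

/-- The indices of the upper `r` rows. -/
abbrev Upper (m r : ℕ) : Type := {i : Fin m // (i : ℕ) < r}

/-- The indices of the lower `m - r` rows. -/
abbrev Lower (m r : ℕ) : Type := {i : Fin m // ¬ (i : ℕ) < r}

/-- The upper `r` rows of a matrix. -/
def upperRows {R : Type*} (r : ℕ) (M : Matrix (Fin m) (Fin m) R) :
    Matrix (Upper m r) (Fin m) R := M.submatrix Subtype.val id

/-- The lower `m - r` rows of a matrix. -/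
def lowerRows {R : Type*} (r : ℕ) (M : Matrix (Fin m) (Fin m) R) :
    Matrix (Lower m r) (Fin m) R := M.submatrix Subtype.val id

/-- The matrix `T = diag(1_r, t 1_{m-r})`. -/
def shiftMatrix (q : Kˣ) (m r : ℕ) : Matrix (Fin m) (Fin m) (PolyOp q) :=
  Matrix.diagonal fun i => if (i : ℕ) < r then 1 else opT q

/-- The block matrix with rows `(1_r, 0)` and `(-X, 1_{m-r})`. -/
def elimMatrix {r : ℕ} (X : Matrix (Lower m r) (Upper m r) K[X]) : Matrix (Fin m) (Fin m) K[X] :=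
  Matrix.reindex (Equiv.sumCompl fun i : Fin m => (i : ℕ) < r)
    (Equiv.sumCompl fun i : Fin m => (i : ℕ) < r) (Matrix.fromBlocks 1 0 (-X) 1)

/-- The states of the algorithm. -/
inductive State (q : Kˣ) (m : ℕ) : Type _
  /-- The beginning of the outer loop, with current matrix `A`. -/
  | outer (A : Matrix (Fin m) (Fin m) (PolyOp q)) : State q m
  /-- The beginning of the inner loop, with current matrix `A` and rank `r`. -/
  | inner (r : ℕ) (A : Matrix (Fin m) (Fin m) (PolyOp q)) : State q m
  /-- The matrix `B` has been returned. -/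
  | done (B : Matrix (Fin m) (Fin m) (PolyOp q)) : State q m

/-- The result of left multiplication of `A` by a matrix over `K[σ]`. -/
def sigmaMul (X : Matrix (Fin m) (Fin m) K[X]) (A : Matrix (Fin m) (Fin m) (PolyOp q)) :
    Matrix (Fin m) (Fin m) (PolyOp q) := X.map (sigmaEmb q) * A

/-- One pass through the body of the inner loop at `A` with rank `r`. The lower rows of `A` are
multiplied by `t`, which gives `T A` with `t`-leading matrix `(B; C)`. The rows of `C` are reduced
by `B`: `C = Z B + Y`, where no row of `Y` is reducible by `B`. The same row operation is applied
to `T A`: with `X^(ℓ) = Z`, the new matrix is `A' = (1, 0; -X, 1) T A`. -/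
def InnerPass (r : ℕ) (A : Matrix (Fin m) (Fin m) (PolyOp q))
    (Y : Matrix (Lower m r) (Fin m) K[X]) (A' : Matrix (Fin m) (Fin m) (PolyOp q)) : Prop :=
  ∃ X Z : Matrix (Lower m r) (Upper m r) K[X],
    lowerRows r (tLeading (shiftMatrix q m r * A)) =
      Z * upperRows r (tLeading (shiftMatrix q m r * A)) + Y ∧
    (∀ i, ¬ IsReducible (upperRows r (tLeading (shiftMatrix q m r * A))) (Y i)) ∧
    X.map (twist q (tDegree (shiftMatrix q m r * A))) = Z ∧
    A' = sigmaMul (elimMatrix X) (shiftMatrix q m r * A)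

/-- The transitions of the algorithm. All choices that the algorithm leaves open (the
transformation to Popov normal form, the order of the rows of that form, the reduction) are left
open here. -/
inductive Step : State q m → State q m → Prop
  /-- If `det Ã_ℓ ≠ 0`, then return `A`. -/
  | ret (A : Matrix (Fin m) (Fin m) (PolyOp q)) (h : (tLeading A).det ≠ 0) :
      Step (.outer A) (.done A)
  /-- Else compute the Popov normal form `U Ã_ℓ = (B; 0)`, where `B` has `r` rows and `U` is
  unimodular over `K[σ]`, and apply the same row operations to `A`: replace `A` by `X A`, where
  `X^(ℓ) = U`. -/
  | popov (A : Matrix (Fin m) (Fin m) (PolyOp q)) (h : (tLeading A).det = 0)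
      (X U : Matrix (Fin m) (Fin m) K[X]) (hU : IsUnit U)
      (hX : X.map (twist q (tDegree A)) = U) (r : ℕ) (hr : r ≤ m)
      (hB : IsPopov (upperRows r (U * tLeading A)))
      (hZ : lowerRows r (U * tLeading A) = 0) :
      Step (.outer A) (.inner r (sigmaMul X A))
  /-- If `Y = 0`, then continue the inner loop. -/
  | innerAgain (r : ℕ) (A A' : Matrix (Fin m) (Fin m) (PolyOp q))
      (h : InnerPass r A 0 A') :
      Step (.inner r A) (.inner r A')
  /-- If `Y ≠ 0`, then go back to the outer loop. -/
  | innerExit (r : ℕ) (A A' : Matrix (Fin m) (Fin m) (PolyOp q))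
      (Y : Matrix (Lower m r) (Fin m) K[X]) (hY : Y ≠ 0) (h : InnerPass r A Y A') :
      Step (.inner r A) (.outer A')

/-- The algorithm with input `A` can reach the state `s`. -/
def Reaches (A : Matrix (Fin m) (Fin m) (PolyOp q)) (s : State q m) : Prop :=
  Relation.ReflTransGen Step (State.outer A) s

end QRec

end

/-!
An operator in `K[t,σ]` is a sum `∑ᵢ tⁱ pᵢ` with `pᵢ` in the commutative ring `K[σ]`, and left
multiplication by `x ∈ K[σ]` multiplies `pᵢ` by the twist `x^(i)`. Every step multiplies the
current matrix from the left by a matrix that is invertible over `K(t)[σ]`, so equivalence with the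
input and regularity are preserved; what has to be shown is that every step can be carried out, and
that no run is infinite.

Steps can be carried out because Popov normal forms and division with remainder exist. Both are
obtained by encoding a row vector `v` over `K[σ]` as the polynomial `∑ₖ vₖ(X^m) X^(m-1-k)`: then the
term over position ordering becomes the ordering of `ℕ`, the leading term becomes the degree, and
its position becomes the degree modulo `m`. Row operations that minimize the total degree of the
encoded rows make the positions of the leading terms distinct (`exists_isPopov_upperRows`), and then there
is no cancellation of leading terms in combinations of the rows (`exists_natDegree_encode_sum_eq`).

The degree `ℓ` in `t` never changes (`tDegree_sigmaMul`, `tDegree_shiftMatrix_mul`), and in the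
inner loop the `t`-leading matrix is `(P; 0)` with `P` in Popov normal form (`InnerInvariant`).

The inner loop terminates (`not_forall_innerPass_zero`): if it did not, the successive values
`L₀, L₁, …` of a lower row would all have degree less than `ℓ` in `t`, hence would be left linearly
dependent over `K[σ]`, being infinitely many elements of a module of rank `ℓ m`. But `Lₙ` is `tⁿ L₀`
plus a combination of the upper rows, which never change, so a relation `∑ gₙ Lₙ = 0` is a linear
relation between the rows of the initial matrix with the coefficient `∑ gₙ tⁿ ≠ 0` at `L₀`. This
contradicts regularity.

The outer loop terminates (`not_exists_infinite_run`): when the inner loop is left, the nonzero rows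
of `Y` are irreducible by `P`, so they are not in the row module of `P`, and the row module of the
`t`-leading matrix has grown strictly (`InnerInvariant.rowModule_lt`). The module `K[σ]^{1×m}` is
Noetherian.
-/

noncomputable section

namespace QRec

/-! ### Operators as polynomials in `t` with coefficients in `K[σ]` -/

section OperatorCoefficients

variable {K : Type*} [Field K] {q : Kˣ}

theorem coeff_tCoeff (i : ℕ) (p : PolyOp q) (j : ℕ) :
    (tCoeff i p).coeff j = (sigmaCoeff p j).coeff i := by
  simp only [tCoeff, finsetSum_coeff, coeff_monomial]
  rw [Finset.sum_ite_eq']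
  split_ifs with h
  · rfl
  · rw [SkewPolynomial.notMem_support_iff] at h
    simp [sigmaCoeff, h]

theorem sigmaCoeff_add (p r : PolyOp q) (j : ℕ) :
    sigmaCoeff (p + r) j = sigmaCoeff p j + sigmaCoeff r j := by
  simp [sigmaCoeff, SkewPolynomial.coeff_add]

/-- The coefficient of `t ^ i`, as an additive map `K[t,σ] → K[σ]`. -/
def tCoeffHom (q : Kˣ) (i : ℕ) : PolyOp q →+ K[X] where
  toFun := tCoeff i
  map_zero' := by ext j; simp [coeff_tCoeff, sigmaCoeff]
  map_add' p r := by ext j; simp [coeff_tCoeff, sigmaCoeff_add]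

theorem tCoeffHom_apply (i : ℕ) (p : PolyOp q) : tCoeffHom q i p = tCoeff i p := rfl

theorem eq_zero_of_tCoeff_eq_zero {p : PolyOp q} (h : ∀ i, tCoeff i p = 0) : p = 0 := by
  apply SkewPolynomial.ext
  intro j
  have : sigmaCoeff p j = 0 := by
    ext i
    rw [← coeff_tCoeff, h]; simp
  simpa [sigmaCoeff] using this

theorem sigmaCoeff_monomial (n j : ℕ) (a : PolyT q) :
    sigmaCoeff (SkewPolynomial.monomial n a : PolyOp q) j =
      if n = j then (toPolyT q).symm a else 0 := by
  rw [sigmaCoeff, SkewPolynomial.coeff_monomial]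
  split_ifs <;> simp

theorem sigmaCoeff_opPoly_mul (a : K[X]) (p : PolyOp q) (j : ℕ) :
    sigmaCoeff (opPoly q a * p) j = a * sigmaCoeff p j := by
  induction p using SkewPolynomial.induction with
  | h0 => simp [sigmaCoeff]
  | ha n r p _ _ ih =>
    rw [mul_add, sigmaCoeff_add, sigmaCoeff_add, ih, mul_add, opPoly, RingHom.comp_apply,
      SkewPolynomial.CRingHom_eq_C, SkewPolynomial.C_mul_monomial, sigmaCoeff_monomial,
      sigmaCoeff_monomial]
    split_ifs <;> simp

theorem sigmaCoeff_opSigma_mul_succ (p : PolyOp q) (j : ℕ) :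
    sigmaCoeff (opSigma q * p) (j + 1) = polyShift q (sigmaCoeff p j) := by
  induction p using SkewPolynomial.induction with
  | h0 => simp [sigmaCoeff]
  | ha n r p _ _ ih =>
    rw [mul_add, sigmaCoeff_add, sigmaCoeff_add, ih, map_add, opSigma,
      SkewPolynomial.X_mul_monomial, sigmaCoeff_monomial, sigmaCoeff_monomial]
    congr 1
    by_cases h : n = j
    · simp only [h, if_true]
      rfl
    · simp [h]

theorem sigmaCoeff_opSigma_mul_zero (p : PolyOp q) : sigmaCoeff (opSigma q * p) 0 = 0 := by
  induction p using SkewPolynomial.induction with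
  | h0 => simp [sigmaCoeff]
  | ha n r p _ _ ih =>
    rw [mul_add, sigmaCoeff_add, ih, opSigma, SkewPolynomial.X_mul_monomial, sigmaCoeff_monomial]
    simp

theorem coeff_polyShift (p : K[X]) (i : ℕ) :
    (polyShift q p).coeff i = (q : K) ^ i * p.coeff i := by
  rw [polyShift, coe_compRingHom_apply, comp_C_mul_X_coeff, mul_comm]

/-- The map `X ↦ X^(l)` of `K[σ]`, with `X^(l) = X(q^l σ)`, as a ring automorphism. -/
def twistEquiv (q : Kˣ) (l : ℕ) : K[X] ≃+* K[X] :=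
  RingEquiv.ofRingHom (compRingHom (C ((q : K) ^ l) * X))
    (compRingHom (C (((q⁻¹ : Kˣ) : K) ^ l) * X))
    (by ext <;> simp [← mul_assoc, ← C_mul, -map_pow])
    (by ext <;> simp [← mul_assoc, ← C_mul, -map_pow])

theorem twistEquiv_apply (l : ℕ) (p : K[X]) : twistEquiv q l p = twist q l p := rfl

theorem twist_symm (l : ℕ) (p : K[X]) : twist q l ((twistEquiv q l).symm p) = p :=
  (twistEquiv q l).apply_symm_apply p

theorem sigmaEmb_X : sigmaEmb q X = opSigma q := by simp [sigmaEmb]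

theorem sigmaEmb_C (c : K) : sigmaEmb q (C c) = opPoly q (C c) := by simp [sigmaEmb]

theorem tCoeff_sigmaEmb_mul (i : ℕ) (x : K[X]) (p : PolyOp q) :
    tCoeff i (sigmaEmb q x * p) = twist q i x * tCoeff i p := by
  have hC : ∀ (c : K) (p : PolyOp q),
      tCoeff i (sigmaEmb q (C c) * p) = twist q i (C c) * tCoeff i p := by
    intro c p
    ext j
    simp [twist, sigmaEmb_C, coeff_tCoeff, sigmaCoeff_opPoly_mul]
  have hX : ∀ p : PolyOp q, tCoeff i (sigmaEmb q X * p) = twist q i X * tCoeff i p := by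
    intro p
    ext j
    rw [sigmaEmb_X, coeff_tCoeff, twist, X_comp, mul_assoc, coeff_C_mul]
    cases j with
    | zero => simp [sigmaCoeff_opSigma_mul_zero]
    | succ j =>
      rw [sigmaCoeff_opSigma_mul_succ, coeff_polyShift, coeff_X_mul, coeff_tCoeff]
  induction x using Polynomial.induction_on generalizing p with
  | C c => exact hC c p
  | add x y hx hy =>
    rw [map_add, add_mul, ← tCoeffHom_apply, map_add, tCoeffHom_apply, tCoeffHom_apply, hx, hy,
      ← twistEquiv_apply, ← twistEquiv_apply, ← twistEquiv_apply, map_add, add_mul]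
  | monomial n c ih =>
    rw [pow_succ, ← mul_assoc, map_mul, mul_assoc, ih, hX, ← mul_assoc, ← twistEquiv_apply,
      ← twistEquiv_apply, ← twistEquiv_apply, map_mul _ (C c * X ^ n)]

theorem tCoeff_opT_mul_succ (i : ℕ) (p : PolyOp q) : tCoeff (i + 1) (opT q * p) = tCoeff i p := by
  ext j
  rw [coeff_tCoeff, coeff_tCoeff, opT, sigmaCoeff_opPoly_mul, coeff_X_mul]

theorem tCoeff_opT_mul_zero (p : PolyOp q) : tCoeff 0 (opT q * p) = 0 := by
  ext j
  rw [coeff_tCoeff, opT, sigmaCoeff_opPoly_mul, coeff_X_mul_zero, coeff_zero]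

theorem tCoeff_opT_pow (i n : ℕ) : tCoeff i (opT q ^ n) = if n = i then 1 else 0 := by
  induction n generalizing i with
  | zero =>
    ext j
    have : (1 : PolyOp q) = SkewPolynomial.monomial 0 1 := rfl
    rw [pow_zero, this, coeff_tCoeff, sigmaCoeff_monomial]
    by_cases hi : i = 0 <;> by_cases hj : j = 0 <;> simp [hi, hj, coeff_one, eq_comm]
  | succ n ih =>
    rw [pow_succ']
    cases i with
    | zero => simp [tCoeff_opT_mul_zero]
    | succ i => rw [tCoeff_opT_mul_succ, ih]; simp

/-- The monomials `t ^ n` are left linearly independent over `K[σ]`. -/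
theorem eq_zero_of_sum_sigmaEmb_mul_opT_pow_eq_zero {s : Finset ℕ} {g : ℕ → K[X]}
    (h : ∑ n ∈ s, sigmaEmb q (g n) * opT q ^ n = 0) {n : ℕ} (hn : n ∈ s) : g n = 0 := by
  have h1 := congrArg (tCoeffHom q n) h
  rw [map_sum, map_zero] at h1
  simp only [tCoeffHom_apply, tCoeff_sigmaEmb_mul, tCoeff_opT_pow, mul_ite, mul_one, mul_zero,
    Finset.sum_ite_eq', hn, if_true, ← twistEquiv_apply] at h1
  simpa using h1

/-! ### The embedding into `K(t)[σ]` -/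

theorem coeff_toRatOp (p : PolyOp q) (j : ℕ) :
    SkewPolynomial.coeff (toRatOp q p) j = polyToRat q (SkewPolynomial.coeff p j) := by
  induction p using SkewPolynomial.induction with
  | h0 => simp
  | ha n r p _ _ ih =>
    have h : toRatOp q (SkewPolynomial.monomial n r) =
        SkewPolynomial.monomial n (polyToRat q r) := by
      have h0 : toRatOp q (SkewPolynomial.monomial n r) =
          SkewPolynomial.CRingHom (polyToRat q r) *
            powersHom (RatOp q) SkewPolynomial.X (Multiplicative.ofAdd n) :=
        SkewMonoidAlgebra.liftNC_single
          (((SkewPolynomial.CRingHom : RatT q →+* RatOp q).comp (polyToRat q) :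
            PolyT q →+* RatOp q) : PolyT q →+ RatOp q) _ _ _
      rw [h0, powersHom_apply, SkewPolynomial.CRingHom_eq_C, toAdd_ofAdd,
        SkewPolynomial.C_mul_X_pow_eq_monomial]
    rw [map_add, SkewPolynomial.coeff_add, SkewPolynomial.coeff_add, ih, map_add, h,
      SkewPolynomial.coeff_monomial, SkewPolynomial.coeff_monomial]
    split_ifs <;> simp

theorem toRatOp_injective : Function.Injective (toRatOp q) := by
  rw [injective_iff_map_eq_zero]
  intro p hp
  apply SkewPolynomial.ext
  intro j
  have h := coeff_toRatOp p j
  rw [hp, SkewPolynomial.coeff_zero] at h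
  have hinj : Function.Injective (polyToRat q) :=
    (RatFunc.algebraMap_injective K : Function.Injective (algebraMap K[X] (RatFunc K)))
  exact hinj (by rw [← h, SkewPolynomial.coeff_zero, map_zero])

theorem isUnit_toRatOp_opT : IsUnit (toRatOp q (opT q)) := by
  have h : toRatOp q (opT q) = SkewPolynomial.CRingHom (polyToRat q (toPolyT q X)) := by
    apply SkewPolynomial.ext
    intro j
    rw [coeff_toRatOp, opT, opPoly, RingHom.comp_apply, SkewPolynomial.CRingHom_eq_C,
      SkewPolynomial.CRingHom_eq_C, SkewPolynomial.coeff_C, SkewPolynomial.coeff_C]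
    split_ifs
    · rfl
    · exact map_zero _
  rw [h]
  refine IsUnit.map _ (isUnit_iff_ne_zero.2 ?_)
  exact (RatFunc.X_ne_zero : (RatFunc.X : RatFunc K) ≠ 0)

end OperatorCoefficients

/-! ### Regularity and equivalence -/

section Equivalence

variable {K : Type*} [Field K] {q : Kˣ} {m : ℕ}

theorem isRegular_iff_vecMul (A : Matrix (Fin m) (Fin m) (PolyOp q)) :
    IsRegular A ↔ ∀ v : Fin m → RatOp q, Matrix.vecMul v (A.map (toRatOp q)) = 0 → v = 0 := by
  rw [IsRegular, Fintype.linearIndependent_iff]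
  have : ∀ v : Fin m → RatOp q, ∑ i, v i • (A.map (toRatOp q)).row i =
      Matrix.vecMul v (A.map (toRatOp q)) := by
    intro v
    ext j
    simp [Matrix.vecMul, dotProduct, Matrix.row]
  simp only [this, funext_iff, Pi.zero_apply]

theorem IsRegular.eq_zero_of_vecMul_eq_zero {A : Matrix (Fin m) (Fin m) (PolyOp q)}
    (hA : IsRegular A) {v : Fin m → PolyOp q} (h : Matrix.vecMul v A = 0) : v = 0 := by
  have h1 : Matrix.vecMul (toRatOp q ∘ v) (A.map (toRatOp q)) = 0 := by
    ext1 j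
    have := congrArg (toRatOp q) (congrFun h j)
    rw [RingHom.map_vecMul] at this
    simpa using this
  have h2 := (isRegular_iff_vecMul A).1 hA _ h1
  ext1 i
  exact toRatOp_injective (by simpa using congrFun h2 i)

theorem IsRegular.of_equivalent {A B : Matrix (Fin m) (Fin m) (PolyOp q)} (hA : IsRegular A)
    (h : Equivalent A B) : IsRegular B := by
  obtain ⟨Q, hQ, hB⟩ := h
  obtain ⟨u, rfl⟩ := hQ
  rw [isRegular_iff_vecMul] at hA ⊢
  intro v hv
  rw [hB, ← Matrix.vecMul_vecMul] at hv
  have := hA _ hv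
  calc v = Matrix.vecMul (Matrix.vecMul v u.1) u⁻¹.1 := by
        rw [Matrix.vecMul_vecMul]; simp
    _ = 0 := by rw [this]; simp

theorem Equivalent.refl (A : Matrix (Fin m) (Fin m) (PolyOp q)) : Equivalent A A :=
  ⟨1, isUnit_one, (one_mul _).symm⟩

theorem Equivalent.mul_left {A B : Matrix (Fin m) (Fin m) (PolyOp q)} (h : Equivalent A B)
    {Q : Matrix (Fin m) (Fin m) (PolyOp q)} (hQ : IsUnit (Q.map (toRatOp q))) :
    Equivalent A (Q * B) := by
  obtain ⟨P, hP, hB⟩ := h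
  exact ⟨Q.map (toRatOp q) * P, hQ.mul hP, by rw [Matrix.map_mul, hB, mul_assoc]⟩

theorem Equivalent.sigmaMul {A B : Matrix (Fin m) (Fin m) (PolyOp q)} (h : Equivalent A B)
    {X : Matrix (Fin m) (Fin m) K[X]} (hX : IsUnit X) : Equivalent A (sigmaMul X B) := by
  refine h.mul_left ?_
  rw [Matrix.map_map]
  exact hX.map ((toRatOp q).comp (sigmaEmb q)).mapMatrix

theorem isUnit_map_shiftMatrix (r : ℕ) : IsUnit ((shiftMatrix q m r).map (toRatOp q)) := by
  have h : (shiftMatrix q m r).map (toRatOp q) =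
      Matrix.diagonal fun i : Fin m => if (i : ℕ) < r then 1 else toRatOp q (opT q) := by
    rw [shiftMatrix, Matrix.diagonal_map (map_zero _)]
    congr 1
    ext1 i
    split_ifs <;> simp
  obtain ⟨u, hu⟩ := (isUnit_toRatOp_opT (q := q))
  rw [h, ← hu]
  have := (Units.map (Matrix.diagonalRingHom (Fin m) (RatOp q)).toMonoidHom
    (MulEquiv.piUnits.symm fun i : Fin m => if (i : ℕ) < r then 1 else u)).isUnit
  convert this using 1
  simp only [Units.coe_map, RingHom.toMonoidHom_eq_coe, MonoidHom.coe_coe,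
    Matrix.diagonalRingHom_apply]
  congr 1
  ext1 i
  simp only [MulEquiv.val_piUnits_symm_apply]
  split_ifs <;> simp

theorem isUnit_elimMatrix {r : ℕ} (X : Matrix (Lower m r) (Upper m r) K[X]) :
    IsUnit (elimMatrix X) := by
  rw [Matrix.isUnit_iff_isUnit_det, elimMatrix, Matrix.det_reindex_self,
    Matrix.det_fromBlocks_zero₁₂]
  simp

theorem Equivalent.elimMatrix_mul_shiftMatrix {A B : Matrix (Fin m) (Fin m) (PolyOp q)}
    (h : Equivalent A B) {r : ℕ} (X : Matrix (Lower m r) (Upper m r) K[X]) :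
    Equivalent A (QRec.sigmaMul (elimMatrix X) (shiftMatrix q m r * B)) :=
  (h.mul_left (isUnit_map_shiftMatrix r)).sigmaMul (isUnit_elimMatrix X)

end Equivalence

/-! ### Row vectors over `K[σ]` encoded as single polynomials -/

section Encoding

variable {K : Type*} [Field K] {m : ℕ}

/-- The rank of a term in the term over position ordering, which is isomorphic to `ℕ`. -/
def Term.code (x : Term m) : ℕ := m * x.exp + (x.pos.rev : ℕ)

theorem Term.code_mod (x : Term m) : x.code % m = x.pos.rev := by
  rw [Term.code, Nat.mul_add_mod, Nat.mod_eq_of_lt x.pos.rev.isLt]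

theorem Term.exists_code_eq [NeZero m] (n : ℕ) : ∃ x : Term m, x.code = n := by
  refine ⟨⟨Fin.rev ⟨n % m, Nat.mod_lt _ (NeZero.pos m)⟩, n / m⟩, ?_⟩
  simp only [Term.code, Fin.rev_rev]
  exact Nat.div_add_mod n m

theorem Term.divides_iff (x y : Term m) :
    x.Divides y ↔ x.code % m = y.code % m ∧ x.code ≤ y.code := by
  rw [Term.Divides, Term.code_mod, Term.code_mod, ← Fin.ext_iff, Fin.rev_inj]
  refine and_congr_right fun h => ?_
  rw [Term.code, Term.code, h, add_le_add_iff_right,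
    Nat.mul_le_mul_left_iff (Fin.pos x.pos)]

theorem Term.topLE_iff (x y : Term m) : x.topLE y ↔ x.code ≤ y.code := by
  have hx := x.pos.rev.isLt
  have hy := y.pos.rev.isLt
  have hr : y.pos ≤ x.pos ↔ (x.pos.rev : ℕ) ≤ y.pos.rev := by
    rw [← Fin.le_def, Fin.rev_le_rev]
  rw [Term.topLE, hr, Term.code, Term.code]
  rcases lt_trichotomy x.exp y.exp with h | h | h
  · have : m * (x.exp + 1) ≤ m * y.exp := Nat.mul_le_mul_left _ h
    rw [mul_add] at this
    exact ⟨fun _ => by omega, fun _ => Or.inl h⟩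
  · simp [h]
  · have : m * (y.exp + 1) ≤ m * x.exp := Nat.mul_le_mul_left _ h
    rw [mul_add] at this
    constructor <;> omega

/-- The polynomial `∑ₖ vₖ(X ^ m) X ^ (m - 1 - k)`. Its coefficients are those of the row vector `v`,
arranged along the term over position ordering, so that leading terms of row vectors become degrees
of polynomials. -/
def encode : (Fin m → K[X]) →+ K[X] where
  toFun v := ∑ k, expand K m (v k) * X ^ (k.rev : ℕ)
  map_zero' := by simp
  map_add' v w := by simp [add_mul, Finset.sum_add_distrib]

theorem encode_apply (v : Fin m → K[X]) :
    encode v = ∑ k, expand K m (v k) * X ^ (k.rev : ℕ) := rfl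

theorem encode_smul (c : K[X]) (v : Fin m → K[X]) : encode (c • v) = expand K m c * encode v := by
  simp [encode_apply, Finset.mul_sum, mul_assoc]

theorem encode_single (x : Term m) (a : K) :
    encode (Pi.single x.pos (C a * X ^ x.exp)) = C a * X ^ x.code := by
  rw [encode_apply, Finset.sum_eq_single x.pos]
  · simp only [Pi.single_eq_same, map_mul, expand_C, map_pow, expand_X, Term.code, pow_add, pow_mul,
      mul_assoc]
  · intro k _ hk
    simp [Pi.single_eq_of_ne hk]
  · simp

theorem coeff_encode (v : Fin m → K[X]) (x : Term m) :
    (encode v).coeff x.code = termCoeff v x := by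
  have hm := Fin.pos x.pos
  rw [encode_apply, finsetSum_coeff, Finset.sum_eq_single x.pos]
  · rw [Term.code, coeff_mul_X_pow, coeff_expand_mul' hm, termCoeff]
  · intro k _ hk
    rw [coeff_mul_X_pow']
    split_ifs with hle
    · rw [coeff_expand hm, if_neg]
      rintro ⟨c, hc⟩
      have h1 : x.code = m * c + (k.rev : ℕ) := by omega
      have h2 := x.code_mod
      rw [h1, Nat.mul_add_mod, Nat.mod_eq_of_lt k.rev.isLt, ← Fin.ext_iff, Fin.rev_inj] at h2
      exact hk h2
    · rfl
  · simp

theorem encode_injective : Function.Injective (encode : (Fin m → K[X]) →+ K[X]) := by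
  rw [injective_iff_map_eq_zero]
  intro v hv
  ext k a
  have := coeff_encode v ⟨k, a⟩
  rw [hv, coeff_zero] at this
  exact this.symm

theorem encode_ne_zero {v : Fin m → K[X]} : encode v ≠ 0 ↔ v ≠ 0 :=
  (map_ne_zero_iff _ encode_injective)

theorem isLeadingTerm_iff (v : Fin m → K[X]) (x : Term m) :
    IsLeadingTerm v x ↔ v ≠ 0 ∧ (encode v).natDegree = x.code := by
  have : NeZero m := ⟨(Fin.pos x.pos).ne'⟩
  constructor
  · rintro ⟨h1, h2⟩
    rw [← coeff_encode] at h1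
    refine ⟨fun h => h1 (by simp [h]), le_antisymm ?_ (le_natDegree_of_ne_zero h1)⟩
    obtain ⟨y, hy⟩ := Term.exists_code_eq (m := m) (encode v).natDegree
    rw [← hy, ← Term.topLE_iff]
    apply h2
    rw [← coeff_encode, hy]
    exact leadingCoeff_ne_zero.2 fun h => h1 (by simp [h])
  · rintro ⟨h1, h2⟩
    refine ⟨?_, fun y hy => ?_⟩
    · rw [← coeff_encode, ← h2]
      exact leadingCoeff_ne_zero.2 (encode_ne_zero.2 h1)
    · rw [Term.topLE_iff, ← h2]
      exact le_natDegree_of_ne_zero (by rwa [coeff_encode])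

theorem exists_isLeadingTerm [NeZero m] {v : Fin m → K[X]} (hv : v ≠ 0) :
    ∃ x, IsLeadingTerm v x ∧ x.code = (encode v).natDegree := by
  obtain ⟨x, hx⟩ := Term.exists_code_eq (m := m) (encode v).natDegree
  exact ⟨x, (isLeadingTerm_iff v x).2 ⟨hv, hx.symm⟩, hx⟩

theorem isReducible_iff [NeZero m] {ι : Type*} (P : ι → Fin m → K[X]) (v : Fin m → K[X]) :
    IsReducible P v ↔ ∃ k n, P k ≠ 0 ∧ (encode (P k)).natDegree % m = n % m ∧
      (encode (P k)).natDegree ≤ n ∧ (encode v).coeff n ≠ 0 := by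
  constructor
  · rintro ⟨k, x, y, hx, hy, hxy⟩
    rw [isLeadingTerm_iff] at hx
    rw [Term.divides_iff, ← hx.2] at hxy
    exact ⟨k, y.code, hx.1, hxy.1, hxy.2, by rwa [coeff_encode]⟩
  · rintro ⟨k, n, hk, h1, h2, h3⟩
    obtain ⟨x, hx, hx'⟩ := exists_isLeadingTerm hk
    obtain ⟨y, rfl⟩ := Term.exists_code_eq (m := m) n
    rw [coeff_encode] at h3
    exact ⟨k, x, y, hx, h3, by rw [Term.divides_iff, hx']; exact ⟨h1, h2⟩⟩

/-- Cancellation of leading terms: if the leading term of `w` divides that of `v`, then a multiple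
of `w` can be subtracted from `v` so that the leading term drops. -/
theorem exists_degree_encode_sub_lt [NeZero m] {v w : Fin m → K[X]} (hv : v ≠ 0) (hw : w ≠ 0)
    (hmod : (encode w).natDegree % m = (encode v).natDegree % m)
    (hle : (encode w).natDegree ≤ (encode v).natDegree) :
    ∃ c : K[X], (encode (v - c • w)).degree < (encode v).degree := by
  obtain ⟨e, he⟩ := (Nat.modEq_iff_dvd' hle).1 hmod
  have hv' := encode_ne_zero.2 hv
  have hw' := encode_ne_zero.2 hw
  have hlw := leadingCoeff_ne_zero.2 hw'
  have hlv := leadingCoeff_ne_zero.2 hv'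
  refine ⟨C ((encode v).leadingCoeff / (encode w).leadingCoeff) * X ^ e, ?_⟩
  rw [map_sub, encode_smul, map_mul, expand_C, map_pow, expand_X, ← pow_mul]
  apply degree_sub_lt_left _ hv'
  · simp [hlw]
  · rw [degree_mul, degree_C_mul_X_pow _ (div_ne_zero hlv hlw), degree_eq_natDegree hv',
      degree_eq_natDegree hw']
    norm_cast
    omega

end Encoding

/-! ### Popov normal forms over `K[σ]` -/

section Popov

variable {K : Type*} [Field K] {m : ℕ}

/-- If the leading terms of the `P k` have distinct positions, then there is no cancellation of
leading terms in a linear combination of the `P k`. -/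
theorem exists_natDegree_encode_sum_eq {ι : Type*} [Fintype ι] [NeZero m]
    {P : ι → Fin m → K[X]} (h0 : ∀ k, P k ≠ 0)
    (hP : ∀ k l, k ≠ l → (encode (P k)).natDegree % m ≠ (encode (P l)).natDegree % m)
    {c : ι → K[X]} (hc : c ≠ 0) :
    ∑ k, c k • P k ≠ 0 ∧ ∃ k, (encode (∑ k, c k • P k)).natDegree =
      m * (c k).natDegree + (encode (P k)).natDegree := by
  have hm := NeZero.pos m
  have hE : ∀ {k}, c k ≠ 0 → expand K m (c k) ≠ 0 := fun h => (expand_ne_zero hm).2 h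
  have hdeg : ∀ {k}, c k ≠ 0 → (encode (c k • P k)).degree =
      ((m * (c k).natDegree + (encode (P k)).natDegree : ℕ) : WithBot ℕ) := by
    intro k hk
    rw [encode_smul, degree_mul, degree_eq_natDegree (hE hk),
      degree_eq_natDegree (encode_ne_zero.2 (h0 k)), natDegree_expand, mul_comm]
    norm_cast
  have hsum := degree_sum_eq_of_disjoint (fun k => encode (c k • P k)) Finset.univ (by
    rintro k ⟨-, hk⟩ l ⟨-, hl⟩ hkl hd
    have hk' : c k ≠ 0 := fun h => hk (by simp [h])
    have hl' : c l ≠ 0 := fun h => hl (by simp [h])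
    simp only [Function.comp_apply] at hd
    rw [hdeg hk', hdeg hl'] at hd
    norm_cast at hd
    apply hP k l hkl
    have := congrArg (· % m) hd
    simpa [Nat.mul_add_mod] using this)
  rw [← map_sum] at hsum
  obtain ⟨k₀, hk₀⟩ := Function.ne_iff.1 hc
  have hne : (Finset.univ : Finset ι).Nonempty := ⟨k₀, Finset.mem_univ _⟩
  obtain ⟨k, -, hk⟩ := Finset.exists_mem_eq_sup Finset.univ hne
    (fun k => (encode (c k • P k)).degree)
  have hle := Finset.le_sup (f := fun k => (encode (c k • P k)).degree) (Finset.mem_univ k₀)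
  rw [hk] at hle hsum
  have hck : c k ≠ 0 := by
    intro h
    simp only [h, zero_smul, map_zero, degree_zero, le_bot_iff] at hle
    rw [hdeg hk₀] at hle
    exact WithBot.coe_ne_bot hle
  rw [hdeg hck] at hsum
  refine ⟨fun h => ?_, k, natDegree_eq_of_degree_eq_some hsum⟩
  rw [h, map_zero, degree_zero] at hsum
  exact WithBot.coe_ne_bot hsum.symm

theorem IsPopov.ne_zero {ι : Type*} {P : ι → Fin m → K[X]} (hP : IsPopov P) (k : ι) : P k ≠ 0 := by
  obtain ⟨x, hx, -⟩ := hP.monic k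
  exact ((isLeadingTerm_iff _ _).1 hx).1

theorem IsPopov.natDegree_encode_mod_ne {ι : Type*} [NeZero m] {P : ι → Fin m → K[X]}
    (hP : IsPopov P) {k l : ι} (hkl : k ≠ l) :
    (encode (P k)).natDegree % m ≠ (encode (P l)).natDegree % m := by
  intro h
  obtain ⟨x, hx, hx'⟩ := exists_isLeadingTerm (hP.ne_zero k)
  obtain ⟨y, hy, hy'⟩ := exists_isLeadingTerm (hP.ne_zero l)
  rw [← hx', ← hy'] at h
  rcases le_total x.code y.code with hle | hle
  · exact hP.minimal k l hkl x y hx hy ((Term.divides_iff _ _).2 ⟨h, hle⟩)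
  · exact hP.minimal l k hkl.symm y x hy hx ((Term.divides_iff _ _).2 ⟨h.symm, hle⟩)

theorem IsPopov.linearIndependent {ι : Type*} [Fintype ι] [NeZero m] {P : ι → Fin m → K[X]}
    (hP : IsPopov P) : LinearIndependent K[X] P := by
  rw [Fintype.linearIndependent_iff]
  intro c hc k
  by_contra hk
  exact (exists_natDegree_encode_sum_eq hP.ne_zero (fun _ _ => hP.natDegree_encode_mod_ne)
    (Function.ne_iff.2 ⟨k, hk⟩)).1 hc

/-- Rows with leading coefficients `1` whose leading terms have distinct positions are in Popov
normal form. -/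
theorem isPopov_of_natDegree_encode_mod_ne {ι : Type*} [Fintype ι] [NeZero m]
    {P : ι → Fin m → K[X]} (h1 : ∀ k, (encode (P k)).Monic)
    (hP : ∀ k l, k ≠ l → (encode (P k)).natDegree % m ≠ (encode (P l)).natDegree % m) :
    IsPopov P where
  monic k := by
    obtain ⟨x, hx, hx'⟩ := exists_isLeadingTerm (encode_ne_zero.1 (h1 k).ne_zero)
    refine ⟨x, hx, ?_⟩
    rw [← coeff_encode, hx']
    exact h1 k
  groebner v hv hv0 := by
    have h0 : ∀ k, P k ≠ 0 := fun k => encode_ne_zero.1 (h1 k).ne_zero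
    obtain ⟨c, rfl⟩ := (Submodule.mem_span_range_iff_exists_fun _).1 hv
    have hc : c ≠ 0 := by
      rintro rfl
      simp at hv0
    obtain ⟨-, k, hk⟩ := exists_natDegree_encode_sum_eq h0 hP hc
    obtain ⟨x, hx, hx'⟩ := exists_isLeadingTerm (h0 k)
    obtain ⟨y, hy, hy'⟩ := exists_isLeadingTerm hv0
    refine ⟨k, x, y, hx, hy, (Term.divides_iff _ _).2 ?_⟩
    rw [hx', hy', hk, Nat.mul_add_mod]
    exact ⟨rfl, Nat.le_add_left _ _⟩
  minimal k l hkl x y hx hy hxy := by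
    rw [Term.divides_iff, ← ((isLeadingTerm_iff _ _).1 hx).2,
      ← ((isLeadingTerm_iff _ _).1 hy).2] at hxy
    exact hP k l hkl hxy.1

theorem IsPopov.eq_zero_of_not_isReducible {ι : Type*} {P : ι → Fin m → K[X]} (hP : IsPopov P)
    {v : Fin m → K[X]} (hv : v ∈ Submodule.span K[X] (Set.range P)) (h : ¬ IsReducible P v) :
    v = 0 := by
  by_contra h0
  obtain ⟨k, x, y, hx, hy, hxy⟩ := hP.groebner v hv h0
  exact h ⟨k, x, y, hx, hy.1, hxy⟩

/-- Division with remainder: every row vector can be reduced completely. -/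
theorem exists_eq_sum_add_not_isReducible {ι : Type*} [Fintype ι] [NeZero m]
    (P : ι → Fin m → K[X]) (v : Fin m → K[X]) :
    ∃ (z : ι → K[X]) (y : Fin m → K[X]), v = ∑ k, z k • P k + y ∧ ¬ IsReducible P y := by
  classical
  suffices H : ∀ (n : ℕ) (v : Fin m → K[X]), (encode v).degree < n →
      ∃ (z : ι → K[X]) (y : Fin m → K[X]), v = ∑ k, z k • P k + y ∧ ¬ IsReducible P y by
    obtain ⟨n, hn⟩ : ∃ n : ℕ, (encode v).degree < n :=
      ⟨(encode v).natDegree + 1,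
        lt_of_le_of_lt degree_le_natDegree (by exact_mod_cast Nat.lt_succ_self _)⟩
    exact H n v hn
  intro n
  induction n with
  | zero =>
    intro v hv
    have hv0 : encode v = 0 := by
      rw [← degree_eq_bot, ← Nat.WithBot.lt_zero_iff]
      exact_mod_cast hv
    have : v = 0 := encode_injective (by rw [hv0, map_zero])
    refine ⟨0, 0, by simp [this], ?_⟩
    rw [isReducible_iff]
    simp
  | succ n ih =>
    intro v hv
    by_cases hlt : (encode v).degree < n
    · exact ih v hlt
    have hdeg : (encode v).degree = n := by
      exact le_antisymm (Order.lt_succ_iff.1 (by exact_mod_cast hv)) (not_lt.1 hlt)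
    have hv0 : v ≠ 0 := by
      rintro rfl
      simp at hdeg
    have hnat : (encode v).natDegree = n := natDegree_eq_of_degree_eq_some hdeg
    by_cases hred : ∃ k, P k ≠ 0 ∧ (encode (P k)).natDegree % m = n % m ∧
        (encode (P k)).natDegree ≤ n
    · obtain ⟨k, hk, h1, h2⟩ := hred
      obtain ⟨c, hc⟩ := exists_degree_encode_sub_lt hv0 hk (by rwa [hnat]) (by rwa [hnat])
      obtain ⟨z, y, hz, hy⟩ := ih _ (hdeg ▸ hc)
      refine ⟨z + Pi.single k c, y, ?_, hy⟩
      have : ∑ l, (Pi.single k c : ι → K[X]) l • P l = c • P k := by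
        rw [Finset.sum_eq_single k (fun l _ hl => by simp [Pi.single_eq_of_ne hl]) (by simp)]
        simp
      simp only [Pi.add_apply, add_smul, Finset.sum_add_distrib, this]
      rw [add_right_comm, ← hz, sub_add_cancel]
    · -- The leading term of `v` is irreducible and goes into the remainder.
      obtain ⟨x, hx⟩ := Term.exists_code_eq (m := m) n
      have he := encode_single x (encode v).leadingCoeff
      set w : Fin m → K[X] := Pi.single x.pos (C (encode v).leadingCoeff * X ^ x.exp) with hw
      have hlc := leadingCoeff_ne_zero.2 (encode_ne_zero.2 hv0)
      have hlt' : (encode (v - w)).degree < n := by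
        rw [map_sub, he, ← hdeg, hx]
        apply degree_sub_lt_left
        · rw [hdeg, degree_C_mul_X_pow _ hlc]
        · exact encode_ne_zero.2 hv0
        · simp
      obtain ⟨z, y, hz, hy⟩ := ih _ hlt'
      refine ⟨z, y + w, by rw [← add_assoc, ← hz, sub_add_cancel], ?_⟩
      rw [isReducible_iff] at hy ⊢
      rintro ⟨k, a, hk, h1, h2, h3⟩
      by_cases ha : a = n
      · exact hred ⟨k, hk, ha ▸ h1, ha ▸ h2⟩
      · refine hy ⟨k, a, hk, h1, h2, ?_⟩
        rwa [map_add, he, hx, coeff_add, coeff_C_mul_X_pow, if_neg ha, add_zero] at h3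

/-- The row operations over `K[σ]` that minimize the total degree of the encoded rows lead to rows
whose leading terms have distinct positions. -/
theorem exists_isUnit_natDegree_encode_mod_ne [NeZero m] (M : Matrix (Fin m) (Fin m) K[X]) :
    ∃ U : Matrix (Fin m) (Fin m) K[X], IsUnit U ∧ ∀ i j, i ≠ j → (U * M) i ≠ 0 → (U * M) j ≠ 0 →
      (encode ((U * M) i)).natDegree % m ≠ (encode ((U * M) j)).natDegree % m := by
  classical
  -- The size of a row is one more than the degree of its encoding, and `0` for the zero row.
  let w : (Fin m → K[X]) → ℕ := fun v => if v = 0 then 0 else (encode v).natDegree + 1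
  have hw : ∀ {v v' : Fin m → K[X]}, (encode v').degree < (encode v).degree → w v' < w v := by
    intro v v' h
    have hv : v ≠ 0 := by
      rintro rfl
      simp at h
    by_cases hv' : v' = 0
    · simp [w, hv, hv']
    · simp only [w, hv, hv', if_false]
      have := natDegree_lt_natDegree (encode_ne_zero.2 hv') h
      omega
  let S : Set (Matrix (Fin m) (Fin m) K[X]) := {U | IsUnit U}
  obtain ⟨U, hU, hmin⟩ := (measure fun U : Matrix (Fin m) (Fin m) K[X] =>
    ∑ i, w ((U * M) i)).wf.has_min S ⟨1, isUnit_one⟩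
  refine ⟨U, hU, ?_⟩
  have key : ∀ i j, i ≠ j → (U * M) i ≠ 0 → (U * M) j ≠ 0 →
      (encode ((U * M) j)).natDegree ≤ (encode ((U * M) i)).natDegree →
      (encode ((U * M) j)).natDegree % m ≠ (encode ((U * M) i)).natDegree % m := by
    intro i j hij hi hj hle hmod
    obtain ⟨c, hc⟩ := exists_degree_encode_sub_lt hi hj hmod hle
    have hT : IsUnit (Matrix.transvection i j (-c)) := by
      rw [Matrix.isUnit_iff_isUnit_det, Matrix.det_transvection_of_ne _ _ hij]
      exact isUnit_one
    refine hmin (Matrix.transvection i j (-c) * U) (hT.mul hU) ?_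
    change ∑ k, w ((Matrix.transvection i j (-c) * U * M) k) < ∑ k, w ((U * M) k)
    have hrow : (Matrix.transvection i j (-c) * U * M) i = (U * M) i - c • (U * M) j := by
      ext1 k
      rw [Matrix.mul_assoc, Matrix.transvection_mul_apply_same]
      simp [sub_eq_add_neg]
    refine Finset.sum_lt_sum (fun k _ => ?_) ⟨i, Finset.mem_univ _, ?_⟩
    · by_cases hk : k = i
      · rw [hk, hrow]
        exact (hw hc).le
      · refine le_of_eq (congrArg w ?_)
        ext1 l
        rw [Matrix.mul_assoc, Matrix.transvection_mul_apply_of_ne _ _ _ _ hk]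
    · rw [hrow]
      exact hw hc
  intro i j hij hi hj
  rcases le_total (encode ((U * M) j)).natDegree (encode ((U * M) i)).natDegree with hle | hle
  · exact (key i j hij hi hj hle).symm
  · exact key j i hij.symm hj hi hle

theorem exists_perm_lt_iff (p : Fin m → Prop) :
    ∃ (e : Equiv.Perm (Fin m)) (r : ℕ), r ≤ m ∧ ∀ i : Fin m, (i : ℕ) < r ↔ p (e i) := by
  classical
  set r := Fintype.card {i // p i} with hr
  have hrm : r ≤ m := by simpa using Fintype.card_subtype_le p
  have hcard : Fintype.card {i : Fin m // (i : ℕ) < r} = Fintype.card {i // p i} := by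
    rw [← hr, Fintype.card_congr (Fin.castLEquiv hrm).symm, Fintype.card_fin]
  let e := Fintype.equivOfCardEq hcard
  refine ⟨e.extendSubtype, r, hrm, fun i => ⟨fun h => e.extendSubtype_mem i h, fun h => ?_⟩⟩
  by_contra hi
  exact e.extendSubtype_not_mem i hi h

/-- Existence of the Popov normal form. -/
theorem exists_isPopov_upperRows [NeZero m] (M : Matrix (Fin m) (Fin m) K[X]) :
    ∃ (U : Matrix (Fin m) (Fin m) K[X]) (r : ℕ), IsUnit U ∧ r ≤ m ∧
      IsPopov (upperRows r (U * M)) ∧ lowerRows r (U * M) = 0 := by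
  classical
  obtain ⟨U, hU, hdist⟩ := exists_isUnit_natDegree_encode_mod_ne M
  obtain ⟨e, r, hr, he⟩ := exists_perm_lt_iff fun i => (U * M) i ≠ 0
  -- Besides permuting the rows, make the leading coefficients equal to `1`.
  let a : Fin m → K := fun i =>
    if (U * M) (e i) = 0 then 1 else ((encode ((U * M) (e i))).leadingCoeff)⁻¹
  have ha : ∀ i, a i ≠ 0 := by
    intro i
    by_cases h : (U * M) (e i) = 0
    · simp [a, h]
    · simpa [a, h] using encode_ne_zero.2 h
  let V := Matrix.diagonal (fun i => C (a i)) * U.submatrix e id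
  have hrow : ∀ i, (V * M) i = C (a i) • (U * M) (e i) := by
    intro i
    ext1 k
    simp only [V]
    rw [Matrix.mul_assoc, Matrix.diagonal_mul]
    rfl
  have henc : ∀ i, encode ((V * M) i) = C (a i) * encode ((U * M) (e i)) := by
    intro i
    rw [hrow, encode_smul, expand_C]
  refine ⟨V, r, ?_, hr, ?_, ?_⟩
  · refine IsUnit.mul ?_ ?_
    · rw [Matrix.isUnit_diagonal, Pi.isUnit_iff]
      exact fun i => isUnit_C.2 (ha i).isUnit
    · exact (Matrix.isUnit_submatrix_equiv e (Equiv.refl _)).2 hU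
  · refine isPopov_of_natDegree_encode_mod_ne (fun k => ?_) fun k l hkl => ?_
    · have hk := (he k).1 k.2
      change (encode ((V * M) k)).Monic
      rw [henc, Monic, leadingCoeff_mul, leadingCoeff_C]
      simp only [a, hk, if_false]
      exact inv_mul_cancel₀ (leadingCoeff_ne_zero.2 (encode_ne_zero.2 hk))
    · change (encode ((V * M) k)).natDegree % m ≠ (encode ((V * M) l)).natDegree % m
      rw [henc, henc, natDegree_C_mul (ha _), natDegree_C_mul (ha _)]
      exact hdist _ _ (fun h => hkl (Subtype.ext (e.injective h))) ((he k).1 k.2) ((he l).1 l.2)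
  · ext1 i j
    have hi : (U * M) (e i) = 0 := not_not.1 fun h => i.2 ((he i).2 h)
    change (V * M) i j = 0
    rw [hrow, hi]
    simp

theorem lt_of_isPopov_upperRows [NeZero m] {M : Matrix (Fin m) (Fin m) K[X]} (h : M.det = 0) {r : ℕ}
    (hr : r ≤ m) (hP : IsPopov (upperRows r M)) : r < m := by
  refine lt_of_le_of_ne hr ?_
  rintro rfl
  obtain ⟨v, hv, hv0⟩ := Matrix.exists_vecMul_eq_zero_iff.2 h
  apply hv
  have hli := Fintype.linearIndependent_iff.1 hP.linearIndependent (fun i => v i) (by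
    have : ∑ i : Upper r r, v i • upperRows r M i = ∑ i : Fin r, v i • M i :=
      Fintype.sum_equiv (Equiv.subtypeUnivEquiv fun i : Fin r => i.2) _ _ fun _ => rfl
    rw [this, ← hv0]
    ext1 j
    simp [Matrix.vecMul, dotProduct])
  ext1 i
  exact hli ⟨i, i.2⟩

end Popov

/-! ### Leading matrices under row operations -/

section Leading

variable {K : Type*} [Field K] {q : Kˣ} {m : ℕ}

theorem tCoeff_eq_zero_of_tDegree_lt {A : Matrix (Fin m) (Fin m) (PolyOp q)} {k : ℕ}
    (h : tDegree A < k) (i j : Fin m) : tCoeff k (A i j) = 0 := by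
  ext l
  rw [coeff_tCoeff, coeff_zero]
  by_cases hl : l ∈ SkewPolynomial.support (A i j)
  · apply coeff_eq_zero_of_natDegree_lt
    refine lt_of_le_of_lt ?_ h
    exact (Finset.le_sup (f := fun l => (sigmaCoeff (A i j) l).natDegree) hl).trans
      ((Finset.le_sup (f := fun j => (SkewPolynomial.support (A i j)).sup fun l =>
        (sigmaCoeff (A i j) l).natDegree) (Finset.mem_univ j)).trans
      (Finset.le_sup (f := fun i => Finset.univ.sup fun j =>
        (SkewPolynomial.support (A i j)).sup fun l => (sigmaCoeff (A i j) l).natDegree)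
        (Finset.mem_univ i)))
  · rw [SkewPolynomial.notMem_support_iff] at hl
    simp [sigmaCoeff, hl]

theorem tDegree_le {A : Matrix (Fin m) (Fin m) (PolyOp q)} {l : ℕ}
    (h : ∀ k, l < k → ∀ i j, tCoeff k (A i j) = 0) : tDegree A ≤ l := by
  refine Finset.sup_le fun i _ => Finset.sup_le fun j _ => Finset.sup_le fun n _ => ?_
  rw [natDegree_le_iff_coeff_eq_zero]
  intro k hk
  rw [← coeff_tCoeff, h k hk, coeff_zero]

theorem tDegree_eq {A : Matrix (Fin m) (Fin m) (PolyOp q)} {l : ℕ}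
    (h : ∀ k, l < k → ∀ i j, tCoeff k (A i j) = 0) (h0 : A.map (tCoeff l) ≠ 0) :
    tDegree A = l := by
  refine le_antisymm (tDegree_le h) (not_lt.1 fun hlt => h0 ?_)
  ext1 i j
  exact tCoeff_eq_zero_of_tDegree_lt hlt i j

theorem tLeading_ne_zero {A : Matrix (Fin m) (Fin m) (PolyOp q)} (hA : A ≠ 0) :
    tLeading A ≠ 0 := by
  intro h0
  have h : ∀ i j, tCoeff (tDegree A) (A i j) = 0 := fun i j => congrFun (congrFun h0 i) j
  cases hd : tDegree A with
  | zero =>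
    apply hA
    ext1 i j
    refine eq_zero_of_tCoeff_eq_zero fun k => ?_
    rcases Nat.eq_zero_or_pos k with rfl | hk
    · rw [← hd]
      exact h i j
    · exact tCoeff_eq_zero_of_tDegree_lt (hd ▸ hk) i j
  | succ n =>
    have : tDegree A ≤ n := tDegree_le fun k hk i j => by
      rcases eq_or_lt_of_le (Nat.succ_le_of_lt hk) with rfl | hk'
      · exact (congrArg (fun d => tCoeff d (A i j)) hd).symm.trans (h i j)
      · exact tCoeff_eq_zero_of_tDegree_lt (by omega) i j
    omega

theorem map_tCoeff_sigmaMul (X : Matrix (Fin m) (Fin m) K[X])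
    (A : Matrix (Fin m) (Fin m) (PolyOp q)) (k : ℕ) :
    (sigmaMul X A).map (tCoeff k) = X.map (twist q k) * A.map (tCoeff k) := by
  ext1 i j
  simp only [sigmaMul, Matrix.map_apply, Matrix.mul_apply]
  rw [← tCoeffHom_apply, map_sum]
  simp only [tCoeffHom_apply, tCoeff_sigmaEmb_mul]

/-- Row operations over `K[σ]` act on the `t`-leading matrix by their twists, if they do not
annihilate it. -/
theorem tDegree_sigmaMul {X : Matrix (Fin m) (Fin m) K[X]}
    {A : Matrix (Fin m) (Fin m) (PolyOp q)} (h : X.map (twist q (tDegree A)) * tLeading A ≠ 0) :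
    tDegree (sigmaMul X A) = tDegree A ∧
      tLeading (sigmaMul X A) = X.map (twist q (tDegree A)) * tLeading A := by
  have hd : tDegree (sigmaMul X A) = tDegree A := by
    refine tDegree_eq (fun k hk i j => ?_) (by rwa [map_tCoeff_sigmaMul])
    have h0 : A.map (tCoeff k) = 0 := by
      ext1 i j
      exact tCoeff_eq_zero_of_tDegree_lt hk i j
    have := map_tCoeff_sigmaMul X A k
    rw [h0, Matrix.mul_zero] at this
    exact congrFun (congrFun this i) j
  refine ⟨hd, ?_⟩
  rw [tLeading, hd, map_tCoeff_sigmaMul]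
  rfl

theorem shiftMatrix_mul_upper {r : ℕ} (A : Matrix (Fin m) (Fin m) (PolyOp q)) {i : Fin m}
    (hi : (i : ℕ) < r) : (shiftMatrix q m r * A) i = A i := by
  ext1 j
  rw [shiftMatrix, Matrix.diagonal_mul, if_pos hi, one_mul]

theorem shiftMatrix_mul_lower {r : ℕ} (A : Matrix (Fin m) (Fin m) (PolyOp q)) {i : Fin m}
    (hi : ¬ (i : ℕ) < r) : (shiftMatrix q m r * A) i = opT q • A i := by
  ext1 j
  rw [shiftMatrix, Matrix.diagonal_mul, if_neg hi]
  rfl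

/-- If the lower rows of the `t`-leading matrix vanish, then multiplying the lower rows by `t` does
not raise the degree in `t`. -/
theorem tDegree_shiftMatrix_mul {r : ℕ} {A : Matrix (Fin m) (Fin m) (PolyOp q)}
    (h0 : tLeading A ≠ 0) (hl : lowerRows r (tLeading A) = 0) :
    tDegree (shiftMatrix q m r * A) = tDegree A ∧
      upperRows r (tLeading (shiftMatrix q m r * A)) = upperRows r (tLeading A) := by
  have hlow : ∀ i : Fin m, ¬ (i : ℕ) < r → ∀ j, tCoeff (tDegree A) (A i j) = 0 :=
    fun i hi j => congrFun (congrFun hl ⟨i, hi⟩) j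
  have hd : tDegree (shiftMatrix q m r * A) = tDegree A := by
    apply tDegree_eq
    · intro k hk i j
      by_cases hi : (i : ℕ) < r
      · rw [shiftMatrix_mul_upper A hi]
        exact tCoeff_eq_zero_of_tDegree_lt hk i j
      · obtain ⟨k, rfl⟩ := Nat.exists_eq_add_one_of_ne_zero (Nat.ne_zero_of_lt hk)
        rw [shiftMatrix_mul_lower A hi, Pi.smul_apply, smul_eq_mul, tCoeff_opT_mul_succ]
        rcases eq_or_lt_of_le (Nat.le_of_lt_succ hk) with rfl | hk'
        · exact hlow i hi j
        · exact tCoeff_eq_zero_of_tDegree_lt hk' i j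
    · intro hz
      apply h0
      ext1 i j
      by_cases hi : (i : ℕ) < r
      · have := congrFun (congrFun hz i) j
        rwa [Matrix.map_apply, shiftMatrix_mul_upper A hi] at this
      · exact hlow i hi j
  refine ⟨hd, ?_⟩
  ext1 i j
  change tCoeff _ ((shiftMatrix q m r * A) i j) = tCoeff _ (A i j)
  rw [hd, shiftMatrix_mul_upper A i.2]

theorem sum_eq_sum_upper_add_sum_lower {M : Type*} [AddCommMonoid M] (r : ℕ) (f : Fin m → M) :
    ∑ i, f i = ∑ i : Upper m r, f i + ∑ i : Lower m r, f i := by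
  rw [← Equiv.sum_comp (Equiv.sumCompl fun i : Fin m => (i : ℕ) < r) f, Fintype.sum_sum_type]
  rfl

theorem elimMatrix_apply_sumCompl {r : ℕ} (X : Matrix (Lower m r) (Upper m r) K[X])
    (a b : Upper m r ⊕ Lower m r) :
    elimMatrix X (Equiv.sumCompl (fun i : Fin m => (i : ℕ) < r) a)
      (Equiv.sumCompl (fun i : Fin m => (i : ℕ) < r) b) = Matrix.fromBlocks 1 0 (-X) 1 a b := by
  simp [elimMatrix]

theorem map_elimMatrix_mul_upper {R : Type*} [Ring R] (f : K[X] →+* R) {r : ℕ}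
    (X : Matrix (Lower m r) (Upper m r) K[X]) (N : Matrix (Fin m) (Fin m) R) (i : Upper m r) :
    ((elimMatrix X).map f * N) i = N i := by
  ext1 j
  rw [Matrix.mul_apply, sum_eq_sum_upper_add_sum_lower r]
  have h1 : ∀ k : Upper m r, elimMatrix X i k = (1 : Matrix (Upper m r) (Upper m r) K[X]) i k :=
    fun k => elimMatrix_apply_sumCompl X (Sum.inl i) (Sum.inl k)
  have h2 : ∀ k : Lower m r, elimMatrix X i k = 0 :=
    fun k => elimMatrix_apply_sumCompl X (Sum.inl i) (Sum.inr k)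
  simp [h1, h2, Matrix.one_apply, apply_ite f]

theorem map_elimMatrix_mul_lower {R : Type*} [Ring R] (f : K[X] →+* R) {r : ℕ}
    (X : Matrix (Lower m r) (Upper m r) K[X]) (N : Matrix (Fin m) (Fin m) R) (i : Lower m r) :
    ((elimMatrix X).map f * N) i = N i - ∑ k : Upper m r, f (X i k) • N k := by
  ext1 j
  rw [Matrix.mul_apply, sum_eq_sum_upper_add_sum_lower r]
  have h1 : ∀ k : Upper m r, elimMatrix X i k = - X i k :=
    fun k => elimMatrix_apply_sumCompl X (Sum.inr i) (Sum.inl k)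
  have h2 : ∀ k : Lower m r, elimMatrix X i k = (1 : Matrix (Lower m r) (Lower m r) K[X]) i k :=
    fun k => elimMatrix_apply_sumCompl X (Sum.inr i) (Sum.inr k)
  simp [h1, h2, Matrix.one_apply, apply_ite f, sub_eq_neg_add]

end Leading

/-! ### The inner loop -/

section InnerLoop

variable {K : Type*} [Field K] {q : Kˣ} {m : ℕ}

/-- The invariant of the inner loop: the `t`-leading matrix is `(P; 0)`, where `P ≠ 0` has `r < m`
rows and is in Popov normal form. -/
structure InnerInvariant (r : ℕ) (A : Matrix (Fin m) (Fin m) (PolyOp q)) : Prop where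
  lt : r < m
  isPopov : IsPopov (upperRows r (tLeading A))
  lower_eq_zero : lowerRows r (tLeading A) = 0
  ne_zero : tLeading A ≠ 0

theorem IsRegular.ne_zero [NeZero m] {A : Matrix (Fin m) (Fin m) (PolyOp q)} (hA : IsRegular A) :
    A ≠ 0 := by
  rintro rfl
  refine LinearIndependent.ne_zero (0 : Fin m) hA ?_
  ext1 j
  simp [Matrix.row]

/-- Passing to the Popov normal form establishes the invariant of the inner loop. -/
theorem InnerInvariant.of_popov {A : Matrix (Fin m) (Fin m) (PolyOp q)} (hA : IsRegular A)
    (h : (tLeading A).det = 0) {X U : Matrix (Fin m) (Fin m) K[X]} (hU : IsUnit U)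
    (hX : X.map (twist q (tDegree A)) = U) {r : ℕ} (hr : r ≤ m)
    (hB : IsPopov (upperRows r (U * tLeading A))) (hZ : lowerRows r (U * tLeading A) = 0) :
    InnerInvariant r (sigmaMul X A) ∧ tLeading (sigmaMul X A) = U * tLeading A := by
  have : NeZero m := ⟨by rintro rfl; simp at h⟩
  have h0 : U * tLeading A ≠ 0 := by
    rw [Ne, hU.mul_right_eq_zero]
    exact tLeading_ne_zero hA.ne_zero
  have hL := (tDegree_sigmaMul (X := X) (A := A) (by rwa [hX])).2
  rw [hX] at hL
  have hdet : (U * tLeading A).det = 0 := by rw [Matrix.det_mul, h, mul_zero]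
  rw [← hL] at h0 hB hZ hdet
  exact ⟨⟨lt_of_isPopov_upperRows hdet hr hB, hB, hZ, h0⟩, hL⟩

/-- One pass of the inner loop keeps the degree in `t`, and turns the `t`-leading matrix `(P; 0)`
into `(P; Y)`. -/
theorem InnerInvariant.innerPass {r : ℕ} {A A' : Matrix (Fin m) (Fin m) (PolyOp q)}
    (hA : InnerInvariant r A) {Y : Matrix (Lower m r) (Fin m) K[X]} (h : InnerPass r A Y A') :
    tDegree A' = tDegree A ∧ upperRows r (tLeading A') = upperRows r (tLeading A) ∧
      lowerRows r (tLeading A') = Y ∧ tLeading A' ≠ 0 := by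
  obtain ⟨X, Z, hC, -, hX, rfl⟩ := h
  obtain ⟨hd, hu⟩ := tDegree_shiftMatrix_mul hA.ne_zero hA.lower_eq_zero
  set T := shiftMatrix q m r * A with hT
  let f : K[X] →+* K[X] := (twistEquiv q (tDegree T) : K[X] →+* K[X])
  have hf : (elimMatrix X).map (twist q (tDegree T)) = (elimMatrix X).map f := rfl
  have hup : upperRows r ((elimMatrix X).map f * tLeading T) = upperRows r (tLeading A) := by
    rw [← hu]
    ext1 i j
    exact congrFun (map_elimMatrix_mul_upper f X (tLeading T) i) j
  have hlo : lowerRows r ((elimMatrix X).map f * tLeading T) = Y := by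
    ext1 i j
    refine (congrFun (map_elimMatrix_mul_lower f X (tLeading T) i) j).trans ?_
    have h1 := congrFun (congrFun hC i) j
    rw [← hX] at h1
    change tLeading T i j = (∑ k, f (X i k) * tLeading T k j) + Y i j at h1
    simp [h1, Finset.sum_apply]
  have hP : upperRows r (tLeading A) ≠ 0 := by
    intro hP
    apply hA.ne_zero
    ext1 i j
    by_cases hi : (i : ℕ) < r
    · exact congrFun (congrFun hP ⟨i, hi⟩) j
    · exact congrFun (congrFun hA.lower_eq_zero ⟨i, hi⟩) j
  have h0 : (elimMatrix X).map f * tLeading T ≠ 0 := by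
    intro h0
    apply hP
    rw [← hup, h0]
    rfl
  rw [← hf] at h0 hup hlo
  obtain ⟨hd', hL⟩ := tDegree_sigmaMul h0
  rw [hd', hd, hL]
  exact ⟨rfl, hup, hlo, h0⟩

theorem InnerInvariant.innerPass_zero {r : ℕ} {A A' : Matrix (Fin m) (Fin m) (PolyOp q)}
    (hA : InnerInvariant r A) (h : InnerPass r A 0 A') : InnerInvariant r A' := by
  obtain ⟨-, hu, hl, h0⟩ := hA.innerPass h
  exact ⟨hA.lt, hu ▸ hA.isPopov, hl, h0⟩

theorem InnerPass.upper_eq {r : ℕ} {A A' : Matrix (Fin m) (Fin m) (PolyOp q)}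
    {Y : Matrix (Lower m r) (Fin m) K[X]} (h : InnerPass r A Y A') {i : Fin m} (hi : (i : ℕ) < r) :
    A' i = A i := by
  obtain ⟨X, Z, -, -, -, rfl⟩ := h
  exact (map_elimMatrix_mul_upper (sigmaEmb q) X _ ⟨i, hi⟩).trans (shiftMatrix_mul_upper A hi)

theorem InnerPass.exists_lower_eq {r : ℕ} {A A' : Matrix (Fin m) (Fin m) (PolyOp q)}
    {Y : Matrix (Lower m r) (Fin m) K[X]} (h : InnerPass r A Y A') {i : Fin m}
    (hi : ¬ (i : ℕ) < r) :
    ∃ x : Upper m r → PolyOp q, A' i = opT q • A i - ∑ k : Upper m r, x k • A k := by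
  obtain ⟨X, Z, -, -, -, rfl⟩ := h
  refine ⟨fun k => sigmaEmb q (X ⟨i, hi⟩ k), ?_⟩
  have h1 : ((elimMatrix X).map (sigmaEmb q) * (shiftMatrix q m r * A)) i =
      (shiftMatrix q m r * A) i -
        ∑ k : Upper m r, sigmaEmb q (X ⟨i, hi⟩ k) • (shiftMatrix q m r * A) k :=
    map_elimMatrix_mul_lower (sigmaEmb q) X _ ⟨i, hi⟩
  have h2 : ∀ k : Upper m r, (shiftMatrix q m r * A) k = A k :=
    fun k => shiftMatrix_mul_upper A k.2
  simp only [h2] at h1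
  rw [sigmaMul, h1, shiftMatrix_mul_lower A hi]

theorem Equivalent.innerPass {A B B' : Matrix (Fin m) (Fin m) (PolyOp q)} {r : ℕ}
    {Y : Matrix (Lower m r) (Fin m) K[X]} (hA : Equivalent A B) (h : InnerPass r B Y B') :
    Equivalent A B' := by
  obtain ⟨X, Z, -, -, -, rfl⟩ := h
  exact hA.elimMatrix_mul_shiftMatrix X

theorem exists_innerPass [NeZero m] (r : ℕ) (A : Matrix (Fin m) (Fin m) (PolyOp q)) :
    ∃ Y A', InnerPass r A Y A' := by
  set T := shiftMatrix q m r * A with hT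
  choose z y hzy hy using fun i : Lower m r =>
    exists_eq_sum_add_not_isReducible (upperRows r (tLeading T)) (lowerRows r (tLeading T) i)
  let Z : Matrix (Lower m r) (Upper m r) K[X] := Matrix.of z
  let Y : Matrix (Lower m r) (Fin m) K[X] := Matrix.of y
  refine ⟨Y, _, Z.map (twistEquiv q (tDegree T)).symm, Z, ?_, hy, ?_, rfl⟩
  · ext1 i j
    have := congrFun (hzy i) j
    simpa [Z, Y, Matrix.mul_apply, Finset.sum_apply] using this
  · ext1 i j
    exact twist_symm _ _

/-- The inner loop terminates. The successive values `L₀, L₁, …` of a lower row have bounded degree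
in `t`, so they are linearly dependent over `K[σ]`. As `Lₙ` is `tⁿ L₀` up to a combination of the
upper rows, this gives a linear dependence between the rows of the first matrix. -/
theorem not_forall_innerPass_zero {r : ℕ} {B : ℕ → Matrix (Fin m) (Fin m) (PolyOp q)}
    (hreg : IsRegular (B 0)) (h0 : InnerInvariant r (B 0))
    (h : ∀ n, InnerPass r (B n) 0 (B (n + 1))) : False := by
  have hinv : ∀ n, InnerInvariant r (B n) := by
    intro n
    induction n with
    | zero => exact h0
    | succ n ih => exact ih.innerPass_zero (h n)
  have hd : ∀ n, tDegree (B n) = tDegree (B 0) := by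
    intro n
    induction n with
    | zero => rfl
    | succ n ih => rw [((hinv n).innerPass (h n)).1, ih]
  have hup : ∀ n (k : Upper m r), B n k = B 0 k := by
    intro n k
    induction n with
    | zero => rfl
    | succ n ih => rw [(h n).upper_eq k.2, ih]
  set l := tDegree (B 0)
  let i : Fin m := ⟨r, h0.lt⟩
  have hi : ¬ (i : ℕ) < r := lt_irrefl r
  have hlow : ∀ n k, l ≤ k → ∀ j, tCoeff k (B n i j) = 0 := by
    intro n k hk j
    rcases eq_or_lt_of_le hk with rfl | hk
    · have := congrFun (congrFun (hinv n).lower_eq_zero ⟨i, hi⟩) j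
      rw [← hd n]
      exact this
    · exact tCoeff_eq_zero_of_tDegree_lt (by rwa [hd n]) i j
  have hc : ∀ n, ∃ c : Fin m → PolyOp q, c i = opT q ^ n ∧ B n i = Matrix.vecMul c (B 0) := by
    intro n
    induction n with
    | zero => exact ⟨Pi.single i 1, by simp, by simp [Matrix.row]⟩
    | succ n ih =>
      obtain ⟨c, hc, hB⟩ := ih
      obtain ⟨x, hx⟩ := (h n).exists_lower_eq hi
      refine ⟨opT q • c - ∑ k : Upper m r, x k • Pi.single (k : Fin m) 1, ?_, ?_⟩
      · have : ∀ k : Upper m r, (Pi.single (k : Fin m) (1 : PolyOp q) : Fin m → PolyOp q) i = 0 :=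
          fun k => Pi.single_eq_of_ne (fun hk => hi (by rw [hk]; exact k.2)) _
        simp [Finset.sum_apply, this, hc, pow_succ']
      · rw [hx, Matrix.sub_vecMul, Matrix.smul_vecMul, ← hB, Matrix.sum_vecMul]
        congr 1
        refine Finset.sum_congr rfl fun k _ => ?_
        rw [Matrix.smul_vecMul, Matrix.single_one_vecMul, hup n k]
        rfl
  choose c hci hcB using hc
  -- Untwisting the coefficients makes left multiplication by `K[σ]` linear in each of them.
  let w : ℕ → Fin l × Fin m → K[X] := fun n x =>
    (twistEquiv q x.1).symm (tCoeff x.1 (B n i x.2))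
  have hw : ¬ LinearIndependent K[X] w := fun hw =>
    not_finite_iff_infinite.2 (inferInstance : Infinite ℕ) hw.finite_of_isNoetherian
  obtain ⟨s, g, hg, n, hn, hgn⟩ := not_linearIndependent_iff.1 hw
  have hsum : ∑ n ∈ s, sigmaEmb q (g n) • B n i = 0 := by
    ext1 j
    refine eq_zero_of_tCoeff_eq_zero fun k => ?_
    rw [Finset.sum_apply, ← tCoeffHom_apply, map_sum]
    simp only [Pi.smul_apply, smul_eq_mul, tCoeffHom_apply, tCoeff_sigmaEmb_mul]
    rcases lt_or_ge k l with hk | hk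
    · have h1 := congrArg (twistEquiv q k) (congrFun hg (⟨k, hk⟩, j))
      simpa [w, Finset.sum_apply, map_sum, ← twistEquiv_apply] using h1
    · simp [hlow _ k hk j]
  have hv : Matrix.vecMul (∑ n ∈ s, sigmaEmb q (g n) • c n) (B 0) = 0 := by
    rw [← hsum, Matrix.sum_vecMul]
    exact Finset.sum_congr rfl fun n _ => by rw [Matrix.smul_vecMul, ← hcB]
  have h1 := congrFun (hreg.eq_zero_of_vecMul_eq_zero hv) i
  simp only [Finset.sum_apply, Pi.smul_apply, hci, smul_eq_mul, Pi.zero_apply] at h1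
  exact hgn (eq_zero_of_sum_sigmaEmb_mul_opT_pow_eq_zero h1 hn)

end InnerLoop

/-! ### The outer loop -/

section OuterLoop

variable {K : Type*} [Field K] {q : Kˣ} {m : ℕ}

/-- The `K[σ]`-module generated by the rows of a matrix. -/
def rowModule (M : Matrix (Fin m) (Fin m) K[X]) : Submodule K[X] (Fin m → K[X]) :=
  Submodule.span K[X] (Set.range M.row)

theorem rowModule_mul_le (U M : Matrix (Fin m) (Fin m) K[X]) :
    rowModule (U * M) ≤ rowModule M := by
  rw [rowModule, Submodule.span_le]
  rintro _ ⟨i, rfl⟩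
  have : (U * M).row i = ∑ k, U i k • M.row k := by
    ext1 j
    simp [Matrix.mul_apply, Matrix.row, Finset.sum_apply]
  rw [this]
  exact Submodule.sum_mem _ fun k _ => Submodule.smul_mem _ _ (Submodule.subset_span ⟨k, rfl⟩)

theorem rowModule_mul {U : Matrix (Fin m) (Fin m) K[X]} (hU : IsUnit U)
    (M : Matrix (Fin m) (Fin m) K[X]) : rowModule (U * M) = rowModule M := by
  refine le_antisymm (rowModule_mul_le U M) ?_
  obtain ⟨u, rfl⟩ := hU
  calc rowModule M = rowModule (u⁻¹.1 * (u.1 * M)) := by rw [← mul_assoc]; simp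
    _ ≤ _ := rowModule_mul_le _ _

/-- When the inner loop is left, the row module of the `t`-leading matrix has grown. -/
theorem InnerInvariant.rowModule_lt {r : ℕ} {A A' : Matrix (Fin m) (Fin m) (PolyOp q)}
    (hA : InnerInvariant r A) {Y : Matrix (Lower m r) (Fin m) K[X]} (hY : Y ≠ 0)
    (h : InnerPass r A Y A') : rowModule (tLeading A) < rowModule (tLeading A') := by
  obtain ⟨hd, hu, hl, -⟩ := hA.innerPass h
  have hP : rowModule (tLeading A) =
      Submodule.span K[X] (Set.range (upperRows r (tLeading A))) := by
    apply le_antisymm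
    · rw [rowModule, Submodule.span_le]
      rintro _ ⟨i, rfl⟩
      by_cases hi : (i : ℕ) < r
      · exact Submodule.subset_span ⟨⟨i, hi⟩, rfl⟩
      · have : (tLeading A).row i = 0 := congrFun hA.lower_eq_zero ⟨i, hi⟩
        rw [this]
        exact Submodule.zero_mem _
    · refine Submodule.span_mono ?_
      rintro _ ⟨i, rfl⟩
      exact ⟨i, rfl⟩
  refine lt_of_le_of_ne ?_ fun heq => hY ?_
  · rw [hP, ← hu]
    refine Submodule.span_mono ?_
    rintro _ ⟨i, rfl⟩
    exact ⟨i, rfl⟩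
  · have hmem : ∀ i, Y i ∈ Submodule.span K[X] (Set.range (upperRows r (tLeading A))) := by
      intro i
      rw [← hP, heq, ← hl]
      exact Submodule.subset_span ⟨i, rfl⟩
    obtain ⟨X, Z, -, hred, -, -⟩ := h
    rw [(tDegree_shiftMatrix_mul hA.ne_zero hA.lower_eq_zero).2] at hred
    funext i
    exact hA.isPopov.eq_zero_of_not_isReducible (hmem i) (hred i)

theorem isUnit_of_map_twist {l : ℕ} {X U : Matrix (Fin m) (Fin m) K[X]} (hU : IsUnit U)
    (hX : X.map (twist q l) = U) : IsUnit X := by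
  have := hU.map (twistEquiv q l).symm.toRingHom.mapMatrix
  rw [← hX] at this
  convert this using 1
  ext1 i j
  exact ((twistEquiv q l).symm_apply_apply _).symm

/-- The outer loop terminates, because the row module of the `t`-leading matrix grows strictly and
`K[σ]^{1×m}` is Noetherian. -/
theorem not_exists_infinite_run (A : Matrix (Fin m) (Fin m) (PolyOp q)) (hA : IsRegular A)
    (run : ℕ → State q m) (h0 : run 0 = State.outer A) (hrun : ∀ n, Step (run n) (run (n + 1))) :
    False := by
  induction hN : rowModule (tLeading A) using WellFoundedGT.induction generalizing A run with
  | ind N ih =>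
  have h1 := hrun 0
  rw [h0] at h1
  generalize hs : run (0 + 1) = s at h1
  cases h1 with
  | ret _ h =>
    have h2 := hrun 1
    rw [hs] at h2
    cases h2
  | popov _ h X U hU hX r hr hB hZ =>
    obtain ⟨hinv, hL⟩ := InnerInvariant.of_popov hA h hU hX hr hB hZ
    have hreg := hA.of_equivalent ((Equivalent.refl A).sigmaMul (isUnit_of_map_twist hU hX))
    have hrow : rowModule (tLeading (sigmaMul X A)) = N := by rw [hL, rowModule_mul hU, hN]
    -- By the induction hypothesis, the run never leaves the inner loop.
    have hstep : ∀ n B, run (n + 1) = State.inner r B → IsRegular B → InnerInvariant r B →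
        rowModule (tLeading B) = N → ∃ B', run (n + 2) = State.inner r B' ∧ InnerPass r B 0 B' := by
      intro n B hn hBreg hBinv hBN
      have h3 := hrun (n + 1)
      rw [hn] at h3
      generalize hs' : run (n + 1 + 1) = s' at h3
      cases h3 with
      | innerAgain _ _ B' hp => exact ⟨B', rfl, hp⟩
      | innerExit _ _ B' Y hY hp =>
        have hB' := hBreg.of_equivalent ((Equivalent.refl B).innerPass hp)
        exact (ih _ (hBN ▸ hBinv.rowModule_lt hY hp) B' hB' (fun k => run (n + 2 + k)) hs'
          (fun k => hrun (n + 2 + k)) rfl).elim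
    have hall : ∀ n, ∃ B, run (n + 1) = State.inner r B ∧ IsRegular B ∧ InnerInvariant r B ∧
        rowModule (tLeading B) = N := by
      intro n
      induction n with
      | zero => exact ⟨_, hs, hreg, hinv, hrow⟩
      | succ n ihn =>
        obtain ⟨B, hn, hBreg, hBinv, hBN⟩ := ihn
        obtain ⟨B', hn', hp⟩ := hstep n B hn hBreg hBinv hBN
        have hBinv' := hBinv.innerPass_zero hp
        have hL' : tLeading B' = tLeading B := by
          obtain ⟨-, hu, hl, -⟩ := hBinv.innerPass hp
          ext1 i j
          by_cases hi : (i : ℕ) < r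
          · exact congrFun (congrFun hu ⟨i, hi⟩) j
          · exact congrFun (congrFun (hl.trans hBinv.lower_eq_zero.symm) ⟨i, hi⟩) j
        exact ⟨B', hn', hBreg.of_equivalent ((Equivalent.refl B).innerPass hp), hBinv',
          by rw [hL', hBN]⟩
    choose B hB using hall
    refine not_forall_innerPass_zero (B := B) (hB 0).2.1 (hB 0).2.2.1 fun n => ?_
    obtain ⟨B', hn', hp⟩ := hstep n (B n) (hB n).1 (hB n).2.1 (hB n).2.2.1 (hB n).2.2.2
    have := hn'.symm.trans (hB (n + 1)).1
    rw [State.inner.injEq] at this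
    exact this.2 ▸ hp

/-- The invariant of the states of a run with input `A`: the current matrix is equivalent to `A`,
the inner loop keeps its own invariant, and a returned matrix is `t`-head regular. -/
def State.Invariant (A : Matrix (Fin m) (Fin m) (PolyOp q)) : State q m → Prop
  | .outer B => Equivalent A B
  | .inner r B => Equivalent A B ∧ InnerInvariant r B
  | .done B => Equivalent A B ∧ (tLeading B).det ≠ 0

theorem State.Invariant.step {A : Matrix (Fin m) (Fin m) (PolyOp q)} (hA : IsRegular A)
    {s s' : State q m} (hs : s.Invariant A) (h : Step s s') : s'.Invariant A := by
  cases h with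
  | ret B h => exact ⟨hs, h⟩
  | popov B h X U hU hX r hr hB hZ =>
    exact ⟨Equivalent.sigmaMul hs (isUnit_of_map_twist hU hX),
      (InnerInvariant.of_popov (hA.of_equivalent hs) h hU hX hr hB hZ).1⟩
  | innerAgain r B B' hp =>
    exact ⟨hs.1.innerPass hp, hs.2.innerPass_zero hp⟩
  | innerExit r B B' Y hY hp =>
    exact hs.1.innerPass hp

theorem State.Invariant.of_reaches {A : Matrix (Fin m) (Fin m) (PolyOp q)} (hA : IsRegular A)
    {s : State q m} (h : Reaches A s) : s.Invariant A := by
  induction h with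
  | refl => exact Equivalent.refl A
  | tail _ h ih => exact ih.step hA h

theorem State.Invariant.eq_done_or_exists_step {A : Matrix (Fin m) (Fin m) (PolyOp q)}
    {s : State q m} (hs : s.Invariant A) : (∃ B, s = State.done B) ∨ ∃ s', Step s s' := by
  cases s with
  | done B => exact Or.inl ⟨B, rfl⟩
  | outer B =>
    right
    by_cases h : (tLeading B).det = 0
    · have : NeZero m := ⟨by rintro rfl; simp at h⟩
      obtain ⟨U, r, hU, hr, hP, hZ⟩ := exists_isPopov_upperRows (tLeading B)
      refine ⟨_, Step.popov B h (U.map (twistEquiv q (tDegree B)).symm) U hU ?_ r hr hP hZ⟩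
      ext1 i j
      exact twist_symm _ _
    · exact ⟨_, Step.ret B h⟩
  | inner r B =>
    right
    have : NeZero m := ⟨(Nat.zero_lt_of_lt hs.2.lt).ne'⟩
    obtain ⟨Y, B', h⟩ := exists_innerPass r B
    by_cases hY : Y = 0
    · subst hY
      exact ⟨_, Step.innerAgain r B B' h⟩
    · exact ⟨_, Step.innerExit r B B' Y hY h⟩

end OuterLoop

end QRec

end

theorem theorem4p2 {K : Type*} [Field K] [CharZero K] (q : Kˣ)
    (hq : ∀ n : ℕ, 0 < n → q ^ n ≠ 1) {m : ℕ}
    (A : Matrix (Fin m) (Fin m) (QRec.PolyOp q)) (hA : QRec.IsRegular A) :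
    -- no run with input `A` is infinite
    (¬ ∃ run : ℕ → QRec.State q m,
      run 0 = QRec.State.outer A ∧ ∀ n, QRec.Step (run n) (run (n + 1))) ∧
    -- no run with input `A` gets stuck before it returns a matrix
    (∀ s, QRec.Reaches A s →
      (∃ B, s = QRec.State.done B) ∨ ∃ s', QRec.Step s s') ∧
    -- some matrix is returned
    (∃ B, QRec.Reaches A (QRec.State.done B)) ∧
    -- every returned matrix is equivalent to `A` and has a regular `t`-leading matrix
    (∀ B, QRec.Reaches A (QRec.State.done B) →
      QRec.Equivalent A B ∧
      LinearIndependent (Polynomial K) (QRec.tLeading B).row ∧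
      QRec.IsTHeadRegular B) := by
  have hinf : ¬ ∃ run : ℕ → QRec.State q m,
      run 0 = QRec.State.outer A ∧ ∀ n, QRec.Step (run n) (run (n + 1)) :=
    fun ⟨run, h0, hrun⟩ => QRec.not_exists_infinite_run A hA run h0 hrun
  have hstuck : ∀ s, QRec.Reaches A s → (∃ B, s = QRec.State.done B) ∨ ∃ s', QRec.Step s s' :=
    fun s hs => (QRec.State.Invariant.of_reaches hA hs).eq_done_or_exists_step
  refine ⟨hinf, hstuck, ?_, fun B hB => ?_⟩
  · -- Otherwise every reachable state has a successor, and there is an infinite run.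
    by_contra hdone
    have hnext : ∀ s : {s // QRec.Reaches A s}, ∃ s' : {s // QRec.Reaches A s},
        QRec.Step s.1 s'.1 := by
      rintro ⟨s, hs⟩
      rcases hstuck s hs with ⟨B, rfl⟩ | ⟨s', h⟩
      · exact (hdone ⟨B, hs⟩).elim
      · exact ⟨⟨s', hs.tail h⟩, h⟩
    choose next hnext using hnext
    have h0 : QRec.Reaches A (QRec.State.outer A) := Relation.ReflTransGen.refl
    refine hinf ⟨fun n => (next^[n] ⟨QRec.State.outer A, h0⟩).1, rfl, fun n => ?_⟩
    simp only [Function.iterate_succ_apply']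
    exact hnext _
  · obtain ⟨h1, h2⟩ := QRec.State.Invariant.of_reaches hA hB
    exact ⟨h1, Matrix.linearIndependent_rows_of_det_ne_zero h2, h2⟩
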